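/- Let $\mathbb K$ be an algebraically closed field of characteristic zero and let $V$ be a $\mathbb K$-vector space of finite positive dimension. **Bidiagonal triples.** Write $[B,A]=BA-AB$. An ordered triple $A,A',A''$ of linear maps $V\to V$ is a *bidiagonal triple* if each of $A,A',A''$ is diagonalizable and there are orderings $\{V_i\}_{i=0}^d$, $\{V'_i\}_{i=0}^{D}$, $\{V''_i\}_{i=0}^{\delta}$ of the eigenspaces of $A,A',A''$ respectively (with $V_{-1}=V_{d+1}=0$, and similarly for the others) such that * $A'V_i\subseteq V_i+V_{i+1}$ and $A''V_i\subseteq V_{i-1}+V_i$ for $0\le i\le d$; * for $0\le i\le d/2$ the restrictions $[A',A]^{d-2i}:V_i\to V_{d-i}$ and $[A'',A]^{d-2i}:V_{d-i}\to V_i$ are bijections; and the same holds after each cyclic permutation of $(A,A',A'')$ (with the orderings, and $d,D,\delta$, permuted accordingly). The eigenvalues of $A,A',A''$ listed in these orderings are the first, second and third *eigenvalue sequences*. For a bidiagonal triple $d=D=\delta$; this number is the *diameter*. If $d\ge 2$, the *base* of the triple is the common value of $(\theta_{i+1}-\theta_i)/(\theta_i-\theta_{i-1})$, $1\le i\le d-1$,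 over the three eigenvalue sequences; if $d\le 1$, the base is $1$ by convention. **Algebras and modules.** $\mathfrak{sl}_2$ is the Lie algebra with basis $h,e,f$ and $[h,e]=2e$, $[h,f]=-2f$, $[e,f]=h$. A triple $X,Y,Z\in\mathfrak{sl}_2$ is *equitable* if $[X,Y]=2X+2Y$, $[Y,Z]=2Y+2Z$, $[Z,X]=2Z+2X$. An $\mathfrak{sl}_2$-module $V$ is *segregated* if $V$ is spanned by eigenvectors of $h$ with even integer eigenvalues, or $V$ is spanned by eigenvectors of $h$ with odd integer eigenvalues. For $q\in\mathbb K$ nonzero and not a root of unity, $U_q(\mathfrak{sl}_2)$ is the unital associative algebra with generators $k,k^{-1},e,f$ and relations $kk^{-1}=k^{-1}k=1$, $ke=q^2ek$, $kf=q^{-2}fk$, $ef-fe=(k-k^{-1})/(q-q^{-1})$. A triple $x,y,z\in U_q(\mathfrak{sl}_2)$ is *equitable* if $x$ is invertible and $$\frac{qxy-q^{-1}yx}{q-q^{-1}}=\frac{qyz-q^{-1}zy}{q-q^{-1}}=\frac{qzx-q^{-1}xz}{q-q^{-1}}=1 .$$ The equitable generators are $x=k$, $y=k^{-1}+f(q-q^{-1})$,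 $z=k^{-1}-k^{-1}eq(q-q^{-1})$. The *trivial representation* is the algebra map $\varepsilon:U_q(\mathfrak{sl}_2)\to\mathbb K$ with $\varepsilon(k^{\pm1})=1$, $\varepsilon(e)=\varepsilon(f)=0$. A $U_q(\mathfrak{sl}_2)$-module $V$ is *segregated* if $V$ is spanned by eigenvectors of $k$ with eigenvalues $q^i$, $i$ an even integer, or $V$ is spanned by eigenvectors of $k$ with eigenvalues $q^i$, $i$ an odd integer. **Theorem 4.6.** 1. Let $V$ be a segregated $\mathfrak{sl}_2$-module. Then every equitable triple $X,Y,Z$ in $\mathfrak{sl}_2$ acts on $V$ as a reduced bidiagonal triple of base $1$, that is, a bidiagonal triple of base $1$, of some diameter $d$, whose first, second and third eigenvalue sequences are each $\{2i-d\}_{i=0}^d$. 2. Let $q\in\mathbb K$ be nonzero and not a root of unity and let $V$ be a segregated $U_q(\mathfrak{sl}_2)$-module. Then the equitable generators $x,y,z$ act on $V$ as a $q$-reduced bidiagonal triple, that is, a bidiagonal triple, of some diameter $d$, whose first, second and third eigenvalue sequences are each $\{q^{d-2i}\}_{i=0}^d$ and whose base, if $d\ge 2$, is $q^{-2}\neq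 1$. More generally, for every equitable triple $x,y,z$ in $U_q(\mathfrak{sl}_2)$ one has $\varepsilon(x)\in\{1,-1\}$, and $\varepsilon(x)x,\ \varepsilon(x)y,\ \varepsilon(x)z$ act on $V$ as a $q$-reduced bidiagonal triple. In particular $x,y,z$ themselves do so whenever $\varepsilon(x)=1$. -/

import Mathlib

universe u v

/-! ## Bidiagonal triples -/

section Bidiagonal

variable {K V : Type*} [Field K] [AddCommGroup V] [Module K V]

/-- `A` is diagonalizable: `V` is spanned by the eigenvectors of `A`. -/
def EndDiagonalizable (A : Module.End K V) : Prop :=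
  ⨆ μ : K, A.eigenspace μ = ⊤

/-- `θ 0, …, θ d` lists every eigenvalue of `A` exactly once. Equivalently, the eigenspaces
for `θ 0, …, θ d` form an ordering of the eigenspaces of `A`. -/
def IsEigenvalueOrdering (A : Module.End K V) {d : ℕ} (θ : Fin (d + 1) → K) : Prop :=
  Function.Injective θ ∧ ∀ μ : K, A.HasEigenvalue μ ↔ ∃ i, θ i = μ

/-- The `i`-th eigenspace `V_i` in the ordering given by `θ`, with the convention that
`V_i = 0` for every integer `i` outside `{0, …, d}` (in particular `V_{-1} = V_{d+1} = 0`). -/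
def orderedEigenspace (A : Module.End K V) {d : ℕ} (θ : Fin (d + 1) → K) (i : ℤ) :
    Submodule K V :=
  if h : 0 ≤ i ∧ i ≤ d then A.eigenspace (θ ⟨i.toNat, by omega⟩) else ⊥

/-- One third of the conditions on a bidiagonal triple: those which concern the ordered
eigenspaces `V_0, …, V_d` of `A`. Here `[B, A] = B * A - A * B`. -/
structure IsBidiagonalFor (A B C : Module.End K V) {d : ℕ} (θ : Fin (d + 1) → K) : Prop where
  /-- `B V_i ⊆ V_i + V_{i+1}` -/
  raise : ∀ i : ℤ, 0 ≤ i → i ≤ d →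
    (orderedEigenspace A θ i).map B ≤ orderedEigenspace A θ i ⊔ orderedEigenspace A θ (i + 1)
  /-- `C V_i ⊆ V_{i-1} + V_i` -/
  lower : ∀ i : ℤ, 0 ≤ i → i ≤ d →
    (orderedEigenspace A θ i).map C ≤ orderedEigenspace A θ (i - 1) ⊔ orderedEigenspace A θ i
  /-- `[B, A]^{d-2i}` restricts to a bijection `V_i → V_{d-i}` for `0 ≤ i ≤ d/2` -/
  bij_raise : ∀ i : ℕ, 2 * i ≤ d →
    Set.BijOn (⇑((B * A - A * B) ^ (d - 2 * i)))
      (orderedEigenspace A θ i : Set V) (orderedEigenspace A θ ((d : ℤ) - i) : Set V)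
  /-- `[C, A]^{d-2i}` restricts to a bijection `V_{d-i} → V_i` for `0 ≤ i ≤ d/2` -/
  bij_lower : ∀ i : ℕ, 2 * i ≤ d →
    Set.BijOn (⇑((C * A - A * C) ^ (d - 2 * i)))
      (orderedEigenspace A θ ((d : ℤ) - i) : Set V) (orderedEigenspace A θ i : Set V)

/-- `A, A', A''` is a bidiagonal triple on `V` whose first, second and third eigenvalue
sequences (the eigenvalues in the standard orderings of the eigenspaces) are `θ, θ', θ''`.
An ordered triple of linear maps is a bidiagonal triple iff this holds for some `θ, θ', θ''`. -/
structure IsBDTripleWith (A A' A'' : Module.End K V) {d D δ : ℕ}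
    (θ : Fin (d + 1) → K) (θ' : Fin (D + 1) → K) (θ'' : Fin (δ + 1) → K) : Prop where
  diag : EndDiagonalizable A
  diag' : EndDiagonalizable A'
  diag'' : EndDiagonalizable A''
  ordering : IsEigenvalueOrdering A θ
  ordering' : IsEigenvalueOrdering A' θ'
  ordering'' : IsEigenvalueOrdering A'' θ''
  bidiag : IsBidiagonalFor A A' A'' θ
  bidiag' : IsBidiagonalFor A' A'' A θ'
  bidiag'' : IsBidiagonalFor A'' A A' θ''

/-- The ratios `(θ_{i+1} - θ_i) / (θ_i - θ_{i-1})`, `1 ≤ i ≤ d - 1`, are all equal to `b`. -/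
def HasConstantRatio {d : ℕ} (θ : Fin (d + 1) → K) (b : K) : Prop :=
  ∀ (i : ℕ) (h : i + 2 ≤ d),
    (θ ⟨i + 2, by omega⟩ - θ ⟨i + 1, by omega⟩) / (θ ⟨i + 1, by omega⟩ - θ ⟨i, by omega⟩) = b

/-- `b` is the base of a bidiagonal triple of diameter `d` with eigenvalue sequences
`θ, θ', θ''`: the common ratio if `d ≥ 2`, and `1` by convention if `d ≤ 1`. -/
def IsBase {d : ℕ} (θ θ' θ'' : Fin (d + 1) → K) (b : K) : Prop :=
  (2 ≤ d → HasConstantRatio θ b ∧ HasConstantRatio θ' b ∧ HasConstantRatio θ'' b) ∧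
  (d ≤ 1 → b = 1)

/-- The sequence `2i - d`, `0 ≤ i ≤ d`. -/
def linearSeq (K : Type*) [Field K] (d : ℕ) : Fin (d + 1) → K :=
  fun i => 2 * ((i : ℕ) : K) - (d : K)

/-- The sequence `q^{d-2i}`, `0 ≤ i ≤ d`. -/
def geomSeq {K : Type*} [Field K] (q : K) (d : ℕ) : Fin (d + 1) → K :=
  fun i => q ^ ((d : ℤ) - 2 * ((i : ℕ) : ℤ))

/-- `A, A', A''` is a reduced bidiagonal triple of base `1`. -/
def IsReducedBDTripleBaseOne (A A' A'' : Module.End K V) : Prop :=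
  ∃ d : ℕ,
    IsBDTripleWith A A' A'' (linearSeq K d) (linearSeq K d) (linearSeq K d) ∧
    IsBase (linearSeq K d) (linearSeq K d) (linearSeq K d) (1 : K)

/-- `A, A', A''` is a `q`-reduced bidiagonal triple: all its eigenvalue sequences are
`q^{d-2i}`, and its base is `q⁻² ≠ 1` as soon as the base is determined by the triple and not
by convention, that is, if `d ≥ 2`. -/
def IsReducedBDTripleBaseNeOne (q : K) (A A' A'' : Module.End K V) : Prop :=
  ∃ d : ℕ,
    IsBDTripleWith A A' A'' (geomSeq q d) (geomSeq q d) (geomSeq q d) ∧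
    (2 ≤ d → ∃ b : K, b ≠ 1 ∧ b = (q ^ 2)⁻¹ ∧
      IsBase (geomSeq q d) (geomSeq q d) (geomSeq q d) b)

end Bidiagonal

/-! ## The Lie algebra `sl₂` -/

section LieSl2

/-- The Lie algebra `sl₂` over `K`: trace-zero `2 × 2` matrices. -/
abbrev Sl2 (K : Type*) [Field K] := LieAlgebra.SpecialLinear.sl (Fin 2) K

/-- The element `h = diag(1, -1)` of the standard basis `h, e, f`. -/
noncomputable def sl2H (K : Type*) [Field K] : Sl2 K :=
  LieAlgebra.SpecialLinear.singleSubSingle 0 1 1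

/-- `X, Y, Z` is an equitable triple in `sl₂`. -/
def IsEquitableSl2 {K : Type*} [Field K] (X Y Z : Sl2 K) : Prop :=
  ⁅X, Y⁆ = (2 : K) • X + (2 : K) • Y ∧
  ⁅Y, Z⁆ = (2 : K) • Y + (2 : K) • Z ∧
  ⁅Z, X⁆ = (2 : K) • Z + (2 : K) • X

/-- The `sl₂`-module `V` is segregated: `V = V_even` or `V = V_odd`, where `V_even` (`V_odd`) is
the span of the eigenvectors of `h` whose eigenvalue is an even (odd) integer. -/
def IsSegregatedSl2 (K V : Type*) [Field K] [AddCommGroup V] [Module K V]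
    [LieRingModule (Sl2 K) V] : Prop :=
  Submodule.span K {v : V | ∃ i : ℤ, Even i ∧ ⁅sl2H K, v⁆ = (i : K) • v} = ⊤ ∨
  Submodule.span K {v : V | ∃ i : ℤ, Odd i ∧ ⁅sl2H K, v⁆ = (i : K) • v} = ⊤

end LieSl2

/-! ## The quantum algebra `U_q(sl₂)` -/

section Quantum

/-- Names for the four generators of `U_q(sl₂)`. -/
inductive UqGen : Type
  | k
  | kinv
  | e
  | f

/-- The defining relations of `U_q(sl₂)`. -/
inductive UqRel {K : Type*} [Field K] (q : K) :
    FreeAlgebra K UqGen → FreeAlgebra K UqGen → Prop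
  | k_kinv : UqRel q (FreeAlgebra.ι K UqGen.k * FreeAlgebra.ι K UqGen.kinv) 1
  | kinv_k : UqRel q (FreeAlgebra.ι K UqGen.kinv * FreeAlgebra.ι K UqGen.k) 1
  | k_e : UqRel q (FreeAlgebra.ι K UqGen.k * FreeAlgebra.ι K UqGen.e)
      (q ^ 2 • (FreeAlgebra.ι K UqGen.e * FreeAlgebra.ι K UqGen.k))
  | k_f : UqRel q (FreeAlgebra.ι K UqGen.k * FreeAlgebra.ι K UqGen.f)
      ((q ^ 2)⁻¹ • (FreeAlgebra.ι K UqGen.f * FreeAlgebra.ι K UqGen.k))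
  | e_f : UqRel q
      (FreeAlgebra.ι K UqGen.e * FreeAlgebra.ι K UqGen.f
        - FreeAlgebra.ι K UqGen.f * FreeAlgebra.ι K UqGen.e)
      ((q - q⁻¹)⁻¹ • (FreeAlgebra.ι K UqGen.k - FreeAlgebra.ι K UqGen.kinv))

/-- The quantum algebra `U_q(sl₂)`: the unital associative `K`-algebra with generators
`k, k⁻¹, e, f` and the relations `UqRel q`. -/
abbrev UqSl2 {K : Type*} [Field K] (q : K) : Type _ := RingQuot (UqRel q)

/-- The image in `U_q(sl₂)` of a generator. -/
noncomputable def uqGen {K : Type*} [Field K] (q : K) (g : UqGen) : UqSl2 q :=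
  RingQuot.mkAlgHom K (UqRel q) (FreeAlgebra.ι K g)

/-- The values `1, 1, 0, 0` of the generators `k, k⁻¹, e, f` on the trivial module. -/
def uqTrivialValue (K : Type*) [Field K] : UqGen → K
  | .k => 1
  | .kinv => 1
  | .e => 0
  | .f => 0

/-- The one-dimensional trivial representation of `U_q(sl₂)` (its counit): the algebra
homomorphism to `K` with `k, k⁻¹ ↦ 1` and `e, f ↦ 0`. -/
noncomputable def uqCounit {K : Type*} [Field K] (q : K) : UqSl2 q →ₐ[K] K :=
  RingQuot.liftAlgHom K (s := UqRel q)
    ⟨FreeAlgebra.lift K (uqTrivialValue K), by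
      intro a b h
      cases h <;> simp [uqTrivialValue]⟩

/-- `x, y, z` is an equitable triple in `U_q(sl₂)`: `x` is invertible and the three
`q`-commutation relations hold. -/
def IsEquitableUq {K : Type*} [Field K] (q : K) (x y z : UqSl2 q) : Prop :=
  IsUnit x ∧
  (q - q⁻¹)⁻¹ • (q • (x * y) - q⁻¹ • (y * x)) = 1 ∧
  (q - q⁻¹)⁻¹ • (q • (y * z) - q⁻¹ • (z * y)) = 1 ∧
  (q - q⁻¹)⁻¹ • (q • (z * x) - q⁻¹ • (x * z)) = 1

/-- The equitable generator `x = k`. -/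
noncomputable def uqX {K : Type*} [Field K] (q : K) : UqSl2 q := uqGen q .k

/-- The equitable generator `y = k⁻¹ + f (q - q⁻¹)`. -/
noncomputable def uqY {K : Type*} [Field K] (q : K) : UqSl2 q :=
  uqGen q .kinv + (q - q⁻¹) • uqGen q .f

/-- The equitable generator `z = k⁻¹ - k⁻¹ e q (q - q⁻¹)`. -/
noncomputable def uqZ {K : Type*} [Field K] (q : K) : UqSl2 q :=
  uqGen q .kinv - (q * (q - q⁻¹)) • (uqGen q .kinv * uqGen q .e)

/-- The linear map `V → V` by which `u ∈ U_q(sl₂)` acts on the module `V`. -/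
noncomputable def uqAct {K : Type*} [Field K] {q : K} (V : Type*) [AddCommGroup V] [Module K V]
    [Module (UqSl2 q) V] [IsScalarTower K (UqSl2 q) V] (u : UqSl2 q) : Module.End K V :=
  Algebra.lsmul K K V u

/-- The `U_q(sl₂)`-module `V` is segregated: `V = V_even^1` or `V = V_odd^1`, where `V_even^1`
(`V_odd^1`) is the span of the eigenvectors of `k` with eigenvalue `q^i`, `i` an even (odd)
integer. -/
def IsSegregatedUq {K : Type*} [Field K] (q : K) (V : Type*) [AddCommGroup V] [Module K V]
    [Module (UqSl2 q) V] : Prop :=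
  Submodule.span K {v : V | ∃ i : ℤ, Even i ∧ uqGen q .k • v = (q ^ i) • v} = ⊤ ∨
  Submodule.span K {v : V | ∃ i : ℤ, Odd i ∧ uqGen q .k • v = (q ^ i) • v} = ⊤

end Quantum

/-!
In both cases an element of the triple is analysed through its eigenspaces. Let an integer `w`,
the weight, stand for the eigenvalue `q ^ w` for `U_q(sl₂)`, and for the eigenvalue `-w` for `sl₂`.
The defining relations of an equitable triple `x, y, z` say that on the space `W w` of weight `w` of
`x`, after subtracting the scalar of weight `-w`, `y` maps to `W (w - 2)` and `z` to `W (w + 2)`,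
and that the commutators `F = [y, x]` and `E = [z, x]` obey commutation rules like those of `f` and
`e` in `sl₂`. This is `IsWeightTriple`, and it holds for all cyclic rotations of the triple.

From it everything follows by linear algebra. The bijectivity of `F ^ w : W w → W (-w)` is the hard
Lefschetz property, proved without decomposing the module (`lefschetz_injective`). As `y` is
triangular with respect to the eigenspaces of `x`, a bound `d` on the weights of `x` (together with
their parity) is also one for `y`, and `y` is diagonalizable if `x` is
(`WeightsWithin.of_triangular`); going around the cycle, the least bounds for `x, y, z` agree. This
gives `IsWeightTriple.exists_isBDTripleWith`, which needs, besides the relations, only that `x`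
is diagonalizable and that its weights are integers of the same parity.

For `sl₂` that last condition follows because `x` is `0` or has eigenvalues `1, -1` in the natural
representation, and in the latter case it is reached from `h` by triangular steps which preserve the
weights (`sl2_induction`). For `U_q(sl₂)` it follows from the classification of units
(`exists_eq_smul_zpow_of_isUnit`): `x` is invertible, so `x = c k ^ n`, and the trivial
representation shows `c = 1` or `c = -1`. The units are found from the grading of `U_q(sl₂)`: a
representation on which the elements of a spanning set act by visibly independent shifts shows that
a unit is homogeneous, and the counit shows that its degree is `0`.
-/

/-! ### Weight spaces, triangular operators and the hard Lefschetz property -/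

section WeightTriples

variable {K V : Type*} [Field K] [AddCommGroup V] [Module K V]

open Module.End in
/-- `B - μ` is surjective on a sum of eigenspaces of `B` for eigenvalues other than `μ`. -/
theorem exists_sub_smul_apply_eq {B : Module.End K V} {ι : Sort*} {ν : ι → K} {μ : K}
    (hμ : ∀ i, ν i ≠ μ) {u : V} (hu : u ∈ ⨆ i, B.eigenspace (ν i)) :
    ∃ u' ∈ ⨆ i, B.eigenspace (ν i), B u' - μ • u' = u := by
  induction hu using Submodule.iSup_induction' with
  | mem i x hx =>
    refine ⟨(ν i - μ)⁻¹ • x, Submodule.smul_mem _ _ (Submodule.mem_iSup_of_mem i hx), ?_⟩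
    have h : ν i - μ ≠ 0 := sub_ne_zero.mpr (hμ i)
    rw [map_smul, mem_eigenspace_iff.mp hx, smul_comm μ, ← smul_sub, ← sub_smul, smul_smul,
      inv_mul_cancel₀ h, one_smul]
  | zero => exact ⟨0, zero_mem _, by simp⟩
  | add x y _ _ ihx ihy =>
    obtain ⟨x', hx', rfl⟩ := ihx
    obtain ⟨y', hy', rfl⟩ := ihy
    exact ⟨x' + y', add_mem hx' hy', by rw [map_add, smul_add]; abel⟩

open Module.End in
/-- If `B - ν i` maps the `i`-th eigenspace of `A` into the next one, then `B` is diagonalizable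
with eigenvalues among the `ν i`: from the last eigenspace of `A` backwards, an eigenvector `v` of
`A` is corrected to an eigenvector of `B` by a sum of eigenvectors already found, on whose span
`B - ν i` is invertible. -/
theorem iSup_eigenspace_of_triangular {A B : Module.End K V} {d : ℕ} {μ ν : ℕ → K}
    (hν : Function.Injective ν) (hlast : A.eigenspace (μ (d + 1)) = ⊥)
    (hAB : ∀ i ≤ d, ∀ v ∈ A.eigenspace (μ i), B v - ν i • v ∈ A.eigenspace (μ (i + 1)))
    (hA : ⨆ i : ℕ, ⨆ _ : i ≤ d, A.eigenspace (μ i) = ⊤) :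
    ⨆ i : ℕ, ⨆ _ : i ≤ d, B.eigenspace (ν i) = ⊤ := by
  have key : ∀ j i : ℕ, i + j = d + 1 →
      A.eigenspace (μ i) ≤ ⨆ l : {l : ℕ // i ≤ l ∧ l ≤ d}, B.eigenspace (ν l) := by
    intro j
    induction j with
    | zero => rintro i rfl; simp [hlast]
    | succ j ih =>
      intro i hij v hv
      have h1 := ih (i + 1) (by omega) (hAB i (by omega) v hv)
      obtain ⟨u, hu, hu'⟩ := exists_sub_smul_apply_eq (μ := ν i)
        (fun l h => by have := hν h; have := l.2.1; omega) h1
      have h2 : v - u ∈ B.eigenspace (ν i) := by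
        rw [mem_eigenspace_iff, map_sub, smul_sub, ← sub_eq_zero]
        rw [← sub_eq_zero] at hu'
        rw [← neg_eq_zero, ← hu']
        abel
      have h3 : u ∈ ⨆ l : {l : ℕ // i ≤ l ∧ l ≤ d}, B.eigenspace (ν l) := by
        have hle : ⨆ l : {l : ℕ // i + 1 ≤ l ∧ l ≤ d}, B.eigenspace (ν l) ≤
            ⨆ l : {l : ℕ // i ≤ l ∧ l ≤ d}, B.eigenspace (ν l) :=
          iSup_le fun l => le_iSup (fun l : {l : ℕ // i ≤ l ∧ l ≤ d} => B.eigenspace (ν l))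
            ⟨l.1, by have := l.2.1; omega, l.2.2⟩
        exact hle hu
      rw [← sub_add_cancel v u]
      exact add_mem (Submodule.mem_iSup_of_mem (p := fun l : {l : ℕ // i ≤ l ∧ l ≤ d} =>
        B.eigenspace (ν l)) ⟨i, le_rfl, by omega⟩ h2) h3
  rw [eq_top_iff, ← hA]
  refine iSup₂_le fun i hi => (key (d + 1 - i) i (by omega)).trans (iSup_le fun l => ?_)
  exact le_iSup₂ (f := fun (i : ℕ) (_ : i ≤ d) => B.eigenspace (ν i)) l.1 l.2.2

theorem eigenspace_eq_bot_of_iSup_eq_top {A : Module.End K V} {ι : Type*} {ν : ι → K} {μ : K}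
    (hμ : ∀ i, ν i ≠ μ) (hA : ⨆ i, A.eigenspace (ν i) = ⊤) : A.eigenspace μ = ⊥ := by
  have h := A.eigenspaces_iSupIndep μ
  rw [← disjoint_top, ← hA]
  refine h.mono_right (iSup_le fun i => ?_)
  exact le_iSup₂ (f := fun (j : K) (_ : j ≠ μ) => A.eigenspace j) (ν i) (hμ i)

/-- `A` is diagonalizable and each of its eigenvalues is one of `lam d, lam (d - 2), …, lam (-d)`,
where `lam w` is the eigenvalue attached to the weight `w`. -/
def WeightsWithin (lam : ℤ → K) (A : Module.End K V) (d : ℕ) : Prop :=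
  ⨆ i : ℕ, ⨆ _ : i ≤ d, A.eigenspace (lam (d - 2 * i)) = ⊤

theorem WeightsWithin.eigenspace_eq_bot {lam : ℤ → K} {A : Module.End K V} {d : ℕ} {μ : K}
    (h : WeightsWithin lam A d) (hμ : ∀ i : ℕ, i ≤ d → lam (d - 2 * i) ≠ μ) :
    A.eigenspace μ = ⊥ := by
  refine eigenspace_eq_bot_of_iSup_eq_top (ν := fun i : {i : ℕ // i ≤ d} => lam (d - 2 * i.1))
    (fun i => hμ i.1 i.2) ?_
  rw [← show _ = _ from h]
  exact iSup_subtype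

/-- The list `lam d, …, lam (-d)` may be read backwards. -/
theorem iSup_eigenspace_reverse (lam : ℤ → K) (A : Module.End K V) (d : ℕ) :
    ⨆ i : ℕ, ⨆ _ : i ≤ d, A.eigenspace (lam (-(d - 2 * i))) =
      ⨆ i : ℕ, ⨆ _ : i ≤ d, A.eigenspace (lam (d - 2 * i)) := by
  apply le_antisymm <;> refine iSup₂_le fun i hi => ?_
  · refine le_iSup₂_of_le (f := fun (i : ℕ) (_ : i ≤ d) => A.eigenspace (lam (d - 2 * i)))
      (d - i) (by omega) (le_of_eq ?_)
    congr 2; omega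
  · refine le_iSup₂_of_le (f := fun (i : ℕ) (_ : i ≤ d) => A.eigenspace (lam (-(d - 2 * i))))
      (d - i) (by omega) (le_of_eq ?_)
    congr 2; omega

/-- An operator which acts on the eigenspace of `A` of weight `w` as the scalar of weight `-w`,
modulo the eigenspace of weight `w - 2`, has its weights within the same bound as `A`. -/
theorem WeightsWithin.of_triangular {lam : ℤ → K} (hlam : Function.Injective lam)
    {A B : Module.End K V} {d : ℕ} (hA : WeightsWithin lam A d)
    (hAB : ∀ w : ℤ, ∀ v ∈ A.eigenspace (lam w),
      B v - lam (-w) • v ∈ A.eigenspace (lam (w - 2))) :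
    WeightsWithin lam B d := by
  unfold WeightsWithin
  rw [← iSup_eigenspace_reverse]
  refine iSup_eigenspace_of_triangular (μ := fun i : ℕ => lam (d - 2 * i))
    (ν := fun i : ℕ => lam (-(d - 2 * i))) ?_ ?_ ?_ hA
  · intro i j h
    have := hlam h
    omega
  · refine hA.eigenspace_eq_bot fun i hi h => ?_
    have := hlam h
    push_cast at this
    omega
  · intro i _ v hv
    have := hAB _ v hv
    convert this using 3
    push_cast
    ring

/-- The injectivity half of the hard Lefschetz property of `sl₂`. If `F ^ n` kills `v` of weight
`w ≥ n ≥ 1`, then `F ^ (n + 1)` kills `E v`, so `E v = 0` by induction on the weight from above,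
and the commutation rule then gives `F ^ (n - 1) v = 0`. -/
theorem lefschetz_injective {W : ℤ → Submodule K V} {E F : Module.End K V} {N : ℤ}
    (hN : ∀ w, N < w → W w = ⊥) (hE : ∀ w, ∀ v ∈ W w, E v ∈ W (w + 2))
    (hcomm : ∀ (n : ℕ) (w : ℤ), ∀ v ∈ W w, ∃ a b : K, a ≠ 0 ∧
      E ((F ^ (n + 1)) v) = a • (F ^ (n + 1)) (E v) + b • (F ^ n) v ∧
      ((n : ℤ) + 1 ≤ w → b ≠ 0)) {w : ℤ} {v : V} (hv : v ∈ W w) {n : ℕ} (hn : (n : ℤ) ≤ w)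
    (h0 : (F ^ n) v = 0) : v = 0 := by
  have key : ∀ k : ℕ, ∀ w : ℤ, N - w < k → ∀ v ∈ W w, ∀ n : ℕ, (n : ℤ) ≤ w →
      (F ^ n) v = 0 → v = 0 := by
    intro k
    induction k with
    | zero =>
      intro w hw v hv n _ _
      rw [hN w (by push_cast at hw; omega)] at hv
      simpa using hv
    | succ k ih =>
      intro w hw v hv n
      induction n with
      | zero => intro _ h; simpa using h
      | succ n ihn =>
        intro hn h
        obtain ⟨a, b, ha, hab, hb⟩ := hcomm n w v hv
        push_cast at hn hw
        rw [h, map_zero] at hab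
        have hEv : E v = 0 := by
          refine ih (w + 2) (by omega) _ (hE w v hv) (n + 2) (by push_cast; omega) ?_
          have h2 := congrArg F hab
          rw [map_zero, map_add, map_smul, map_smul, ← Module.End.mul_apply F, ← pow_succ',
            ← Module.End.mul_apply F, ← pow_succ', h, smul_zero, add_zero] at h2
          exact (smul_eq_zero.mp h2.symm).resolve_left ha
        rw [hEv, map_zero, smul_zero, zero_add] at hab
        exact ihn (by omega) ((smul_eq_zero.mp hab.symm).resolve_left (hb hn))
  exact key (N - w + 1).toNat w (by omega) v hv n hn h0

/-- The properties of an equitable triple `x, y, z` relative to the weight spaces of `x`, the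
space of weight `w` being the eigenspace of `x` for `lam w`: up to scalars, `y` lowers and `z`
raises weights by `2`, and the commutators `[y, x]` and `[z, x]`, which are pure lowering and
raising operators, obey commutation rules like those of `f` and `e` in `sl₂`. -/
structure IsWeightTriple (lam : ℤ → K) (x y z : Module.End K V) : Prop where
  y_sub : ∀ w : ℤ, ∀ v ∈ x.eigenspace (lam w), y v - lam (-w) • v ∈ x.eigenspace (lam (w - 2))
  z_sub : ∀ w : ℤ, ∀ v ∈ x.eigenspace (lam w), z v - lam (-w) • v ∈ x.eigenspace (lam (w + 2))
  comm_lower : ∀ (n : ℕ) (w : ℤ), ∀ v ∈ x.eigenspace (lam w), ∃ a b : K, a ≠ 0 ∧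
    (z * x - x * z) (((y * x - x * y) ^ (n + 1)) v) =
      a • ((y * x - x * y) ^ (n + 1)) ((z * x - x * z) v) + b • ((y * x - x * y) ^ n) v ∧
    ((n : ℤ) + 1 ≤ w → b ≠ 0)
  comm_raise : ∀ (n : ℕ) (w : ℤ), ∀ v ∈ x.eigenspace (lam w), ∃ a b : K, a ≠ 0 ∧
    (y * x - x * y) (((z * x - x * z) ^ (n + 1)) v) =
      a • ((z * x - x * z) ^ (n + 1)) ((y * x - x * y) v) + b • ((z * x - x * z) ^ n) v ∧
    ((n : ℤ) + 1 ≤ -w → b ≠ 0)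

open Module.End in
/-- If `y` maps the eigenvector `v` of `x` to a multiple of `v` plus an eigenvector `u` of `x`,
then `[y, x]` maps it to a multiple of `u`. -/
theorem commutator_mem_eigenspace {x y : Module.End K V} {α β γ : K} {v : V}
    (hv : v ∈ x.eigenspace α) (hy : y v - β • v ∈ x.eigenspace γ) :
    (y * x - x * y) v ∈ x.eigenspace γ := by
  have h : (y * x - x * y) v = (α - γ) • (y v - β • v) := by
    rw [mem_eigenspace_iff] at hv hy
    rw [map_sub, map_smul, hv, sub_eq_iff_eq_add] at hy
    rw [LinearMap.sub_apply, mul_apply, mul_apply, hv, map_smul, hy]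
    module
  rw [h]
  exact Submodule.smul_mem _ _ hy

namespace IsWeightTriple

variable {lam : ℤ → K} {x y z : Module.End K V}

theorem lower_mem (h : IsWeightTriple lam x y z) {w : ℤ} {v : V}
    (hv : v ∈ x.eigenspace (lam w)) (n : ℕ) :
    ((y * x - x * y) ^ n) v ∈ x.eigenspace (lam (w - 2 * n)) := by
  induction n with
  | zero => simpa using hv
  | succ n ih =>
    rw [pow_succ', Module.End.mul_apply]
    convert commutator_mem_eigenspace ih (h.y_sub _ _ ih) using 3
    push_cast; ring

theorem raise_mem (h : IsWeightTriple lam x y z) {w : ℤ} {v : V}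
    (hv : v ∈ x.eigenspace (lam w)) (n : ℕ) :
    ((z * x - x * z) ^ n) v ∈ x.eigenspace (lam (w + 2 * n)) := by
  induction n with
  | zero => simpa using hv
  | succ n ih =>
    rw [pow_succ', Module.End.mul_apply]
    convert commutator_mem_eigenspace ih (h.z_sub _ _ ih) using 3
    push_cast; ring

theorem eigenspace_eq_bot (hlam : Function.Injective lam) {d : ℕ} (hx : WeightsWithin lam x d)
    {w : ℤ} (hw : d < w ∨ w < -d) : x.eigenspace (lam w) = ⊥ := by
  refine hx.eigenspace_eq_bot fun i hi h => ?_
  have := hlam h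
  omega

theorem lower_injective (h : IsWeightTriple lam x y z) (hlam : Function.Injective lam) {d : ℕ}
    (hx : WeightsWithin lam x d) {w : ℤ} {v : V} (hv : v ∈ x.eigenspace (lam w)) {n : ℕ}
    (hn : (n : ℤ) ≤ w) (h0 : ((y * x - x * y) ^ n) v = 0) : v = 0 :=
  lefschetz_injective (W := fun w => x.eigenspace (lam w)) (E := z * x - x * z) (N := d)
    (fun _ hw => eigenspace_eq_bot hlam hx (Or.inl hw))
    (fun _ _ hv => by simpa using h.raise_mem hv 1) h.comm_lower hv hn h0

theorem raise_injective (h : IsWeightTriple lam x y z) (hlam : Function.Injective lam) {d : ℕ}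
    (hx : WeightsWithin lam x d) {w : ℤ} {v : V} (hv : v ∈ x.eigenspace (lam w)) {n : ℕ}
    (hn : (n : ℤ) ≤ -w) (h0 : ((z * x - x * z) ^ n) v = 0) : v = 0 := by
  refine lefschetz_injective (W := fun w => x.eigenspace (lam (-w))) (E := y * x - x * y) (N := d)
    (fun w hw => eigenspace_eq_bot hlam hx (Or.inr (by omega)))
    (fun w v hv => ?_) (fun n w v hv => ?_) (w := -w) (by simpa using hv) hn h0
  · have := h.lower_mem hv 1
    rw [pow_one] at this
    convert this using 3
    push_cast; ring
  · simpa using h.comm_raise n (-w) v hv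

/-- The hard Lefschetz property. The powers of `[y, x]` and `[z, x]` are injective in opposite
directions, so both spaces have the same dimension. -/
theorem bijOn [FiniteDimensional K V] (h : IsWeightTriple lam x y z)
    (hlam : Function.Injective lam) {d : ℕ} (hx : WeightsWithin lam x d) (n : ℕ) :
    Set.BijOn (⇑((y * x - x * y) ^ n))
      (x.eigenspace (lam n) : Set V) (x.eigenspace (lam (-n)) : Set V) ∧
    Set.BijOn (⇑((z * x - x * z) ^ n))
      (x.eigenspace (lam (-n)) : Set V) (x.eigenspace (lam n) : Set V) := by
  have mF : ∀ v ∈ x.eigenspace (lam n), ((y * x - x * y) ^ n) v ∈ x.eigenspace (lam (-n)) := by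
    intro v hv
    convert h.lower_mem hv n using 3
    ring
  have mE : ∀ v ∈ x.eigenspace (lam (-n)), ((z * x - x * z) ^ n) v ∈ x.eigenspace (lam n) := by
    intro v hv
    convert h.raise_mem hv n using 3
    ring
  let F := ((y * x - x * y) ^ n).restrict mF
  let E := ((z * x - x * z) ^ n).restrict mE
  have iF : Function.Injective F := by
    rw [← LinearMap.ker_eq_bot, LinearMap.ker_eq_bot']
    intro v hv
    exact Subtype.ext (h.lower_injective hlam hx v.2 le_rfl (congrArg Subtype.val hv))
  have iE : Function.Injective E := by
    rw [← LinearMap.ker_eq_bot, LinearMap.ker_eq_bot']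
    intro v hv
    exact Subtype.ext (h.raise_injective hlam hx v.2 (by simp) (congrArg Subtype.val hv))
  have hdim : Module.finrank K (x.eigenspace (lam n)) = Module.finrank K (x.eigenspace (lam (-n))) :=
    le_antisymm (LinearMap.finrank_le_finrank_of_injective iF)
      (LinearMap.finrank_le_finrank_of_injective iE)
  have sF := (LinearMap.injective_iff_surjective_of_finrank_eq_finrank hdim).mp iF
  have sE := (LinearMap.injective_iff_surjective_of_finrank_eq_finrank hdim.symm).mp iE
  refine ⟨⟨mF, fun a ha b hb hab => ?_, fun c hc => ?_⟩, mE, fun a ha b hb hab => ?_, fun c hc => ?_⟩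
  · exact congrArg Subtype.val (@iF ⟨a, ha⟩ ⟨b, hb⟩ (Subtype.ext hab))
  · obtain ⟨a, ha⟩ := sF ⟨c, hc⟩
    exact ⟨a, a.2, congrArg Subtype.val ha⟩
  · exact congrArg Subtype.val (@iE ⟨a, ha⟩ ⟨b, hb⟩ (Subtype.ext hab))
  · obtain ⟨a, ha⟩ := sE ⟨c, hc⟩
    exact ⟨a, a.2, congrArg Subtype.val ha⟩

/-- In the ordering given by the weights `d, d - 2, …, -d`, the convention `V_i = 0` outside the
range `0 ≤ i ≤ d` agrees with the vanishing of the corresponding weight spaces. -/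
theorem orderedEigenspace_eq (hlam : Function.Injective lam) {d : ℕ}
    (hx : WeightsWithin lam x d) (i : ℤ) :
    orderedEigenspace x (fun j : Fin (d + 1) => lam (d - 2 * (j : ℕ))) i =
      x.eigenspace (lam (d - 2 * i)) := by
  unfold orderedEigenspace
  split_ifs with hi
  · simp only
    congr 3
    omega
  · rw [eigenspace_eq_bot hlam hx (by omega)]

theorem isBidiagonalFor [FiniteDimensional K V] (h : IsWeightTriple lam x y z)
    (hlam : Function.Injective lam) {d : ℕ} (hx : WeightsWithin lam x d) :
    IsBidiagonalFor x y z (fun j : Fin (d + 1) => lam (d - 2 * (j : ℕ))) where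
  raise i _ _ := by
    simp only [orderedEigenspace_eq hlam hx]
    rintro _ ⟨v, hv, rfl⟩
    rw [← add_sub_cancel (lam (-(d - 2 * i)) • v) (y v)]
    refine Submodule.add_mem_sup (Submodule.smul_mem _ _ hv) ?_
    convert h.y_sub _ v hv using 3
    ring
  lower i _ _ := by
    simp only [orderedEigenspace_eq hlam hx]
    rintro _ ⟨v, hv, rfl⟩
    rw [← sub_add_cancel (z v) (lam (-(d - 2 * i)) • v)]
    refine Submodule.add_mem_sup ?_ (Submodule.smul_mem _ _ hv)
    convert h.z_sub _ v hv using 3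
    ring
  bij_raise i hi := by
    simp only [orderedEigenspace_eq hlam hx]
    convert (h.bijOn hlam hx (d - 2 * i)).1 using 4 <;> omega
  bij_lower i hi := by
    simp only [orderedEigenspace_eq hlam hx]
    convert (h.bijOn hlam hx (d - 2 * i)).2 using 4 <;> omega

/-- If the bound `d` on the weights is the least possible, all of `d, d - 2, …, -d` are weights:
`-d` is one as soon as `d` is, and the powers of `[y, x]` are injective on the space of
weight `d`. -/
theorem eigenspace_ne_bot [Nontrivial V] (h : IsWeightTriple lam x y z)
    (hlam : Function.Injective lam) {d : ℕ} (hx : WeightsWithin lam x d)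
    (hmin : ∀ d', WeightsWithin lam x d' → d ≤ d') {i : ℕ} (hi : i ≤ d) :
    x.eigenspace (lam (d - 2 * i)) ≠ ⊥ := by
  have htop : x.eigenspace (lam d) ≠ ⊥ := by
    intro hd
    have hd' : x.eigenspace (lam (-d)) = ⊥ := by
      rw [eq_bot_iff]
      intro v hv
      refine h.raise_injective hlam hx hv (n := d) (by simp) ?_
      have := h.raise_mem hv d
      rw [show -(d : ℤ) + 2 * d = d by ring, hd] at this
      simpa using this
    have hz : ∀ i : ℕ, i ≤ d → i = 0 ∨ i = d → x.eigenspace (lam (d - 2 * i)) = ⊥ := by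
      rintro i _ (rfl | rfl)
      · simpa using hd
      · convert hd' using 3
        ring
    rcases Nat.lt_or_ge d 2 with h2 | h2
    · have : (⊤ : Submodule K V) = ⊥ := by
        rw [← show _ = _ from hx, eq_bot_iff]
        refine iSup₂_le fun i hi => (hz i hi (by omega)).le
      exact top_ne_bot this
    · have : WeightsWithin lam x (d - 2) := by
        unfold WeightsWithin
        rw [eq_top_iff, ← show _ = _ from hx]
        refine iSup₂_le fun i hi => ?_
        by_cases h0 : i = 0 ∨ i = d
        · rw [hz i hi h0]
          exact bot_le
        · refine le_iSup₂_of_le (f := fun (i : ℕ) (_ : i ≤ d - 2) =>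
            x.eigenspace (lam ((d - 2 : ℕ) - 2 * i))) (i - 1) (by omega) (le_of_eq ?_)
          congr 2
          omega
      have := hmin _ this
      omega
  obtain ⟨v, hv, hv0⟩ := Submodule.exists_mem_ne_zero_of_ne_bot htop
  intro hbot
  have := h.lower_mem hv i
  rw [hbot, Submodule.mem_bot] at this
  exact hv0 (h.lower_injective hlam hx hv (by exact_mod_cast hi) this)

theorem isEigenvalueOrdering [Nontrivial V] (h : IsWeightTriple lam x y z)
    (hlam : Function.Injective lam) {d : ℕ} (hx : WeightsWithin lam x d)
    (hmin : ∀ d', WeightsWithin lam x d' → d ≤ d') :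
    IsEigenvalueOrdering x (fun j : Fin (d + 1) => lam (d - 2 * (j : ℕ))) := by
  refine ⟨fun i j hij => ?_, fun μ => ⟨fun hμ => ?_, ?_⟩⟩
  · have := hlam hij
    exact Fin.ext (by omega)
  · by_contra hne
    push Not at hne
    exact hμ (hx.eigenspace_eq_bot fun i hi => hne ⟨i, by omega⟩)
  · rintro ⟨i, rfl⟩
    exact h.eigenspace_ne_bot hlam hx hmin (by omega)

theorem _root_.WeightsWithin.endDiagonalizable {d : ℕ} (hx : WeightsWithin lam x d) :
    EndDiagonalizable x := by
  unfold EndDiagonalizable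
  rw [eq_top_iff, ← show _ = _ from hx]
  exact iSup₂_le fun i _ => le_iSup x.eigenspace _

/-- The bounds on the weights of `x`, `y` and `z` are equivalent, because each of the three is
triangular with respect to the weight spaces of its predecessor; hence the three diameters
agree. -/
theorem exists_isBDTripleWith [FiniteDimensional K V] [Nontrivial V]
    (hlam : Function.Injective lam) (h : IsWeightTriple lam x y z)
    (h' : IsWeightTriple lam y z x) (h'' : IsWeightTriple lam z x y)
    (hx : ∃ d, WeightsWithin lam x d) :
    ∃ d : ℕ, IsBDTripleWith x y z (fun j : Fin (d + 1) => lam (d - 2 * (j : ℕ)))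
      (fun j : Fin (d + 1) => lam (d - 2 * (j : ℕ)))
      (fun j : Fin (d + 1) => lam (d - 2 * (j : ℕ))) := by
  classical
  have xy : ∀ d, WeightsWithin lam x d → WeightsWithin lam y d :=
    fun d hd => hd.of_triangular hlam h.y_sub
  have yz : ∀ d, WeightsWithin lam y d → WeightsWithin lam z d :=
    fun d hd => hd.of_triangular hlam h'.y_sub
  have zx : ∀ d, WeightsWithin lam z d → WeightsWithin lam x d :=
    fun d hd => hd.of_triangular hlam h''.y_sub
  have hd := Nat.find_spec hx
  have hmin : ∀ d', WeightsWithin lam x d' → Nat.find hx ≤ d' := fun d' => Nat.find_min' hx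
  generalize Nat.find hx = d at hd hmin
  exact ⟨d, hd.endDiagonalizable, (xy d hd).endDiagonalizable,
    (yz d (xy d hd)).endDiagonalizable, h.isEigenvalueOrdering hlam hd hmin,
    h'.isEigenvalueOrdering hlam (xy d hd) fun e he => hmin e (zx e (yz e he)),
    h''.isEigenvalueOrdering hlam (yz d (xy d hd)) fun e he => hmin e (zx e he),
    h.isBidiagonalFor hlam hd, h'.isBidiagonalFor hlam (xy d hd),
    h''.isBidiagonalFor hlam (yz d (xy d hd))⟩

end IsWeightTriple

/-- On a finite-dimensional space spanned by eigenvectors whose weights have the same parity,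
the weights are bounded. -/
theorem exists_weightsWithin [FiniteDimensional K V] {lam : ℤ → K} {A : Module.End K V} (p : ℕ)
    (h : Submodule.span K {v : V | ∃ i : ℤ, Even (i + p) ∧ A v = lam i • v} = ⊤) :
    ∃ d, WeightsWithin lam A d := by
  have h1 : (⊤ : Submodule K V) ≤ ⨆ i : {i : ℤ // Even (i + p)}, A.eigenspace (lam i) := by
    rw [← h, Submodule.span_le]
    rintro v ⟨i, hi, hv⟩
    exact Submodule.mem_iSup_of_mem (p := fun i : {i : ℤ // Even (i + p)} => A.eigenspace (lam i))
      ⟨i, hi⟩ (Module.End.mem_eigenspace_iff.mpr hv)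
  have hc : IsCompactElement (⊤ : Submodule K V) :=
    (Submodule.fg_iff_compact _).mp Module.Finite.fg_top
  obtain ⟨s, hs⟩ := CompleteLattice.IsCompactElement.exists_finset_of_le_iSup _ hc _ h1
  refine ⟨p + 2 * s.sup fun i => i.1.natAbs, ?_⟩
  unfold WeightsWithin
  rw [eq_top_iff]
  refine hs.trans (iSup₂_le fun i hi => ?_)
  have hle := Finset.le_sup (f := fun i : {i : ℤ // Even (i + p)} => i.1.natAbs) hi
  set m := s.sup fun i => i.1.natAbs
  obtain ⟨r, hr⟩ := i.2
  refine le_iSup₂_of_le (f := fun (j : ℕ) (_ : j ≤ p + 2 * m) =>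
    A.eigenspace (lam ((p + 2 * m : ℕ) - 2 * j))) ((p : ℤ) + m - r).toNat (by omega) (le_of_eq ?_)
  congr 2
  omega

end WeightTriples

/-! ### From the equitable relations to weight triples -/

section EquitableRelations

variable {K V : Type*} [Field K] [AddCommGroup V] [Module K V]

theorem zpow_injective_of_pow_ne_one {q : K} (hq0 : q ≠ 0) (hq : ∀ n : ℕ, 0 < n → q ^ n ≠ 1) :
    Function.Injective (fun n : ℤ => q ^ n) := by
  have key : ∀ m n : ℤ, m < n → q ^ m ≠ q ^ n := by
    intro m n hmn h
    refine hq (n - m).toNat (by omega) ?_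
    rw [← zpow_natCast, Int.toNat_of_nonneg (by omega), zpow_sub₀ hq0, h,
      div_self (zpow_ne_zero _ hq0)]
  intro m n h
  rcases lt_trichotomy m n with hmn | hmn | hmn
  · exact absurd h (key m n hmn)
  · exact hmn
  · exact absurd h.symm (key n m hmn)

/-- The quantum analogue of `[e, f ^ (n + 1)] = (n + 1) f ^ n (h - n)`. -/
theorem quantum_commutation {q : K} (hq0 : q ≠ 0) (hq : ∀ n : ℕ, 0 < n → q ^ n ≠ 1)
    {x E F : Module.End K V} {κ : K} (hκ : κ ≠ 0) (hF : x * F = (q ^ 2)⁻¹ • (F * x))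
    (hEF : E * F = (q ^ 2)⁻¹ • (F * E) + κ • (1 - x * x)) (n : ℕ) {w : ℤ} {v : V}
    (hv : x v = q ^ w • v) :
    ∃ a b : K, a ≠ 0 ∧ E ((F ^ (n + 1)) v) = a • (F ^ (n + 1)) (E v) + b • (F ^ n) v ∧
      ((n : ℤ) + 1 ≤ w → b ≠ 0) := by
  have ht0 : q ^ 2 ≠ 0 := pow_ne_zero 2 hq0
  have ht1 : q ^ 2 - 1 ≠ 0 := sub_ne_zero.mpr (hq 2 two_pos)
  refine ⟨((q ^ 2)⁻¹) ^ (n + 1), κ * ((q ^ 2) ^ n)⁻¹ * (((q ^ 2) ^ (n + 1) - 1) / (q ^ 2 - 1)) *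
    (1 - (q ^ w) ^ 2 * ((q ^ 2) ^ n)⁻¹), pow_ne_zero _ (inv_ne_zero ht0), ?_, fun hn => ?_⟩
  · have hx : ∀ m : ℕ, x ((F ^ m) v) = (q ^ w * ((q ^ 2) ^ m)⁻¹) • (F ^ m) v := by
      intro m
      induction m with
      | zero => simpa using hv
      | succ m ih =>
        rw [pow_succ' F, Module.End.mul_apply, ← Module.End.mul_apply x, hF, LinearMap.smul_apply,
          Module.End.mul_apply, ih, map_smul, smul_smul, pow_succ (q ^ 2), mul_inv]
        congr 1
        ring
    have hEF' : ∀ u : V, E (F u) = (q ^ 2)⁻¹ • F (E u) + κ • (u - x (x u)) := by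
      intro u
      simpa using LinearMap.congr_fun hEF u
    induction n with
    | zero =>
      simp only [zero_add, pow_one, pow_zero, Module.End.one_apply, hEF', hv, map_smul]
      rw [div_self ht1]
      module
    | succ n ih =>
      rw [pow_succ' F (n + 1), Module.End.mul_apply, hEF', ih, hx, map_smul, hx, map_add, map_smul,
        map_smul, ← Module.End.mul_apply F (F ^ n), ← pow_succ', Module.End.mul_apply]
      have hP : (q ^ 2) ^ n ≠ 0 := pow_ne_zero _ ht0
      simp only [pow_succ (q ^ 2)]
      generalize (q ^ 2) ^ n = P at *
      generalize q ^ 2 = t at *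
      match_scalars
      · ring
      · field_simp
        ring
  · have hinj := zpow_injective_of_pow_ne_one hq0 hq
    have h1 : (q ^ 2) ^ (n + 1) - 1 ≠ 0 := by
      rw [← pow_mul]
      exact sub_ne_zero.mpr (hq _ (by positivity))
    have h2 : 1 - (q ^ w) ^ 2 * ((q ^ 2) ^ n)⁻¹ ≠ 0 := by
      rw [sub_ne_zero]
      intro h
      rw [eq_comm, mul_inv_eq_one₀ (pow_ne_zero _ ht0), ← pow_mul, ← zpow_natCast, ← zpow_mul,
        ← zpow_natCast] at h
      have := hinj h
      push_cast at this
      omega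
    exact mul_ne_zero (mul_ne_zero (mul_ne_zero hκ (inv_ne_zero (pow_ne_zero _ ht0)))
      (div_ne_zero h1 ht1)) h2

/-- The relation `q a b - q⁻¹ b a = q - q⁻¹`, solved for `a b`. -/
theorem mul_eq_of_q_commutation {q : K} (hq0 : q ≠ 0) {A : Type*} [Ring A] [Algebra K A] {a b : A}
    (h : q • (a * b) - q⁻¹ • (b * a) = (q - q⁻¹) • (1 : A)) :
    a * b = (q ^ 2)⁻¹ • (b * a) + (1 - (q ^ 2)⁻¹) • (1 : A) := by
  rw [sub_eq_iff_eq_add] at h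
  have h2 := congrArg (fun u => q⁻¹ • u) h
  simp only [smul_smul, smul_add, inv_mul_cancel₀ hq0, one_smul] at h2
  rw [h2]
  match_scalars <;> field_simp

theorem isWeightTriple_of_quantum {q : K} (hq0 : q ≠ 0) (hq : ∀ n : ℕ, 0 < n → q ^ n ≠ 1)
    {x y z : Module.End K V}
    (hxy : q • (x * y) - q⁻¹ • (y * x) = (q - q⁻¹) • (1 : Module.End K V))
    (hyz : q • (y * z) - q⁻¹ • (z * y) = (q - q⁻¹) • (1 : Module.End K V))
    (hzx : q • (z * x) - q⁻¹ • (x * z) = (q - q⁻¹) • (1 : Module.End K V)) :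
    IsWeightTriple (fun w : ℤ => q ^ w) x y z := by
  have ht0 : q ^ 2 ≠ 0 := pow_ne_zero 2 hq0
  have ht1 : 1 - q ^ 2 ≠ 0 := sub_ne_zero.mpr (hq 2 two_pos).symm
  have ht2 : 1 - (q ^ 2)⁻¹ ≠ 0 := by
    rw [sub_ne_zero, ne_comm, inv_ne_one]
    exact hq 2 two_pos
  have h1 := mul_eq_of_q_commutation hq0 hxy
  have h2 := mul_eq_of_q_commutation hq0 hyz
  have h3 : x * z = q ^ 2 • (z * x) + (1 - q ^ 2) • (1 : Module.End K V) := by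
    rw [mul_eq_of_q_commutation hq0 hzx]
    match_scalars <;> field_simp
    ring
  have eF : y * x - x * y = (1 - (q ^ 2)⁻¹) • (y * x - 1) := by
    rw [h1]; module
  have eE : z * x - x * z = (1 - q ^ 2) • (z * x - 1) := by
    rw [h3]; module
  have hF : x * (y * x - x * y) = (q ^ 2)⁻¹ • ((y * x - x * y) * x) := by
    rw [eF, mul_smul_comm, mul_sub, ← mul_assoc, h1, smul_mul_assoc, add_mul, sub_mul,
      smul_mul_assoc, smul_mul_assoc, one_mul, mul_one]
    module
  have hE : x * (z * x - x * z) = q ^ 2 • ((z * x - x * z) * x) := by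
    rw [eE, mul_smul_comm, mul_sub, ← mul_assoc, h3, smul_mul_assoc, add_mul, sub_mul,
      smul_mul_assoc, smul_mul_assoc, one_mul, mul_one]
    module
  have hEF0 : (z * x - 1) * (y * x - 1) =
      (q ^ 2)⁻¹ • ((y * x - 1) * (z * x - 1)) + (1 - (q ^ 2)⁻¹) • (1 - x * x) := by
    have e1 : z * x * (y * x) = z * (x * y) * x := by noncomm_ring
    have e2 : y * x * (z * x) = y * (x * z) * x := by noncomm_ring
    have e3 : z * (y * x) * x = z * y * (x * x) := by noncomm_ring
    have e4 : y * (z * x) * x = y * z * (x * x) := by noncomm_ring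
    simp only [mul_sub, sub_mul, mul_one, one_mul, e1, e2, h1, h3, mul_add, add_mul,
      mul_smul_comm, smul_mul_assoc, e3, e4, h2]
    generalize q ^ 2 = t at *
    match_scalars <;> field_simp <;> ring
  have hEF : (z * x - x * z) * (y * x - x * y) =
      (q ^ 2)⁻¹ • ((y * x - x * y) * (z * x - x * z)) +
        ((1 - q ^ 2) * (1 - (q ^ 2)⁻¹) * (1 - (q ^ 2)⁻¹)) • (1 - x * x) := by
    rw [eE, eF, smul_mul_smul_comm, smul_mul_smul_comm, hEF0]
    module
  have hFE : (y * x - x * y) * (z * x - x * z) =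
      (q⁻¹ ^ 2)⁻¹ • ((z * x - x * z) * (y * x - x * y)) +
        (-(q ^ 2 * ((1 - q ^ 2) * (1 - (q ^ 2)⁻¹) * (1 - (q ^ 2)⁻¹)))) • (1 - x * x) := by
    rw [hEF, inv_pow, inv_inv, smul_add, smul_smul, mul_inv_cancel₀ ht0]
    module
  have hv' : ∀ (w : ℤ) (v : V), v ∈ x.eigenspace (q ^ w) → x v = q ^ w • v :=
    fun w v hv => Module.End.mem_eigenspace_iff.mp hv
  refine ⟨fun w v hv => ?_, fun w v hv => ?_, fun n w v hv => ?_, fun n w v hv => ?_⟩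
  · have h := LinearMap.congr_fun h1 v
    have hv := hv' w v hv
    simp only [Module.End.mul_apply, LinearMap.add_apply, LinearMap.smul_apply,
      Module.End.one_apply, hv, map_smul] at h
    rw [Module.End.mem_eigenspace_iff, map_sub, map_smul, h, hv, zpow_sub₀ hq0, zpow_neg,
      zpow_ofNat]
    have := zpow_ne_zero w hq0
    match_scalars <;> field_simp
    ring
  · have h := LinearMap.congr_fun h3 v
    have hv := hv' w v hv
    simp only [Module.End.mul_apply, LinearMap.add_apply, LinearMap.smul_apply,
      Module.End.one_apply, hv, map_smul] at h
    rw [Module.End.mem_eigenspace_iff, map_sub, map_smul, h, hv, zpow_add₀ hq0, zpow_neg,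
      zpow_ofNat]
    have := zpow_ne_zero w hq0
    match_scalars <;> field_simp
    ring
  · exact quantum_commutation hq0 hq (mul_ne_zero (mul_ne_zero ht1 ht2) ht2) hF hEF n (hv' w v hv)
  -- Replacing `q` by `q⁻¹` exchanges raising and lowering, and negates the weights.
  · refine quantum_commutation (q := q⁻¹) (inv_ne_zero hq0) (fun m hm h => hq m hm ?_)
      (neg_ne_zero.mpr (mul_ne_zero ht0 (mul_ne_zero (mul_ne_zero ht1 ht2) ht2)))
      ?_ hFE n (w := -w) ?_
    · simpa using h
    · rw [hE, inv_pow, inv_inv]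
    · rw [inv_zpow, zpow_neg, inv_inv, hv' w v hv]

/-- The rule `[e, f ^ (n + 1)] = (n + 1) f ^ n (h - n)`, up to normalization. -/
theorem linear_commutation [CharZero K] {x E F : Module.End K V} (hF : x * F = F * x + (2 : K) • F)
    (hEF : E * F = F * E - (16 : K) • x) (n : ℕ) {w : ℤ} {v : V} (hv : x v = (-(w : K)) • v) :
    ∃ a b : K, a ≠ 0 ∧ E ((F ^ (n + 1)) v) = a • (F ^ (n + 1)) (E v) + b • (F ^ n) v ∧
      ((n : ℤ) + 1 ≤ w → b ≠ 0) := by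
  refine ⟨1, 16 * (n + 1) * (w - n), one_ne_zero, ?_, fun hn => ?_⟩
  · have hx : ∀ m : ℕ, x ((F ^ m) v) = (-(w : K) + 2 * m) • (F ^ m) v := by
      intro m
      induction m with
      | zero => simpa using hv
      | succ m ih =>
        rw [pow_succ' F, Module.End.mul_apply, ← Module.End.mul_apply x, hF, LinearMap.add_apply,
          LinearMap.smul_apply, Module.End.mul_apply, ih, map_smul]
        push_cast
        module
    have hEF' : ∀ u : V, E (F u) = F (E u) - (16 : K) • x u := by
      intro u
      simpa using LinearMap.congr_fun hEF u
    induction n with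
    | zero =>
      simp only [zero_add, pow_one, pow_zero, Module.End.one_apply, hEF', hv]
      push_cast
      module
    | succ n ih =>
      rw [pow_succ' F (n + 1), Module.End.mul_apply, hEF', ih, hx, map_add, map_smul,
        map_smul, ← Module.End.mul_apply F (F ^ n), ← pow_succ', Module.End.mul_apply]
      push_cast
      module
  · have h1 : (n : K) + 1 ≠ 0 := by exact_mod_cast n.succ_ne_zero
    have h2 : (w : K) - n ≠ 0 := by
      rw [sub_ne_zero]
      intro h
      have : w = n := by exact_mod_cast h
      omega
    exact mul_ne_zero (mul_ne_zero (by norm_num) h1) h2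

theorem isWeightTriple_of_linear [CharZero K] {x y z : Module.End K V}
    (hxy : x * y - y * x = (2 : K) • x + (2 : K) • y)
    (hyz : y * z - z * y = (2 : K) • y + (2 : K) • z)
    (hzx : z * x - x * z = (2 : K) • z + (2 : K) • x) :
    IsWeightTriple (fun w : ℤ => -(w : K)) x y z := by
  have h1 : x * y = y * x + ((2 : K) • x + (2 : K) • y) := by rw [← hxy]; abel
  have h2 : y * z = z * y + ((2 : K) • y + (2 : K) • z) := by rw [← hyz]; abel
  have h3 : x * z = z * x - ((2 : K) • z + (2 : K) • x) := by rw [← hzx]; abel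
  have eF : y * x - x * y = (-2 : K) • (x + y) := by rw [h1]; module
  have eE : z * x - x * z = (2 : K) • (z + x) := by rw [hzx]; module
  have hF : x * (y * x - x * y) = (y * x - x * y) * x + (2 : K) • (y * x - x * y) := by
    rw [eF, mul_smul_comm, mul_add, h1, smul_mul_assoc, add_mul]
    module
  have hE : x * (z * x - x * z) = (z * x - x * z) * x - (2 : K) • (z * x - x * z) := by
    rw [eE, mul_smul_comm, mul_add, h3, smul_mul_assoc, add_mul]
    module
  have hEF : (z * x - x * z) * (y * x - x * y) =
      (y * x - x * y) * (z * x - x * z) - (16 : K) • x := by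
    rw [eE, eF]
    simp only [mul_smul_comm, smul_mul_assoc, mul_add, add_mul, h1, h2, h3]
    module
  have hv' : ∀ (w : ℤ) (v : V), v ∈ x.eigenspace (-(w : K)) → x v = (-(w : K)) • v :=
    fun w v hv => Module.End.mem_eigenspace_iff.mp hv
  refine ⟨fun w v hv => ?_, fun w v hv => ?_, fun n w v hv => ?_, fun n w v hv => ?_⟩
  · have h := LinearMap.congr_fun h1 v
    have hv := hv' w v hv
    simp only [Module.End.mul_apply, LinearMap.add_apply, LinearMap.smul_apply,
      hv, map_smul] at h
    rw [Module.End.mem_eigenspace_iff, map_sub, map_smul, h, hv]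
    push_cast
    module
  · have h := LinearMap.congr_fun h3 v
    have hv := hv' w v hv
    simp only [Module.End.mul_apply, LinearMap.add_apply, LinearMap.sub_apply,
      LinearMap.smul_apply, hv, map_smul] at h
    rw [Module.End.mem_eigenspace_iff, map_sub, map_smul, h, hv]
    push_cast
    module
  · exact linear_commutation hF hEF n (hv' w v hv)
  -- Replacing `x` by `-x` exchanges raising and lowering, and negates the weights.
  · refine linear_commutation (x := -x) ?_ ?_ n (w := -w) ?_
    · rw [neg_mul, hE, mul_neg]
      abel
    · rw [hEF]
      module
    · rw [LinearMap.neg_apply, hv' w v hv]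
      push_cast
      module

end EquitableRelations

/-! ### The units of `U_q(sl₂)` -/

section UnitsOfUq

variable {K : Type*} [Field K]

/-- A monoid algebra with unique sums has only trivial units: in a product equal to `1`, any
exponent which arises from a single pair of terms is `0`, and two such pairs would coincide. -/
theorem exists_eq_single_of_mul_eq_one {G : Type*} [AddMonoid G] [TwoUniqueSums G]
    {p r : AddMonoidAlgebra K G} (h : p * r = 1) :
    ∃ a b c c', p = AddMonoidAlgebra.single a c ∧ r = AddMonoidAlgebra.single b c' := by
  classical
  have hp : p.coeff.support.Nonempty := by
    rw [Finset.nonempty_iff_ne_empty, Ne, Finsupp.support_eq_empty, AddMonoidAlgebra.coeff_eq_zero]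
    rintro rfl
    simp at h
  have hr : r.coeff.support.Nonempty := by
    rw [Finset.nonempty_iff_ne_empty, Ne, Finsupp.support_eq_empty, AddMonoidAlgebra.coeff_eq_zero]
    rintro rfl
    simp at h
  have hcard : ¬ 1 < p.coeff.support.card * r.coeff.support.card := by
    intro hlt
    obtain ⟨p1, hp1, p2, hp2, hne, hu1, hu2⟩ := TwoUniqueSums.uniqueAdd_of_one_lt_card hlt
    have key : ∀ x ∈ p.coeff.support ×ˢ r.coeff.support,
        UniqueAdd p.coeff.support r.coeff.support x.1 x.2 → x.1 + x.2 = 0 := by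
      intro x hx hu
      rw [Finset.mem_product, Finsupp.mem_support_iff, Finsupp.mem_support_iff] at hx
      have := AddMonoidAlgebra.coeff_mul_add_of_uniqueAdd hu
      rw [h, AddMonoidAlgebra.one_def, AddMonoidAlgebra.coeff_single, Finsupp.single_apply] at this
      by_contra hx0
      rw [if_neg (Ne.symm hx0)] at this
      exact mul_ne_zero hx.1 hx.2 this.symm
    rw [Finset.mem_product] at hp1 hp2
    have h12 := hu1 hp2.1 hp2.2 (by
      rw [key p1 (Finset.mem_product.mpr hp1) hu1, key p2 (Finset.mem_product.mpr hp2) hu2])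
    exact hne (Prod.ext h12.1.symm h12.2.symm)
  have h1 := hp.card_pos
  have h2 := hr.card_pos
  have c1 : p.coeff.support.card ≤ 1 := by nlinarith
  have c2 : r.coeff.support.card ≤ 1 := by nlinarith
  obtain ⟨a, c, hc⟩ := Finsupp.card_support_le_one'.mp c1
  obtain ⟨b, c', hc'⟩ := Finsupp.card_support_le_one'.mp c2
  exact ⟨a, b, c, c', AddMonoidAlgebra.coeff_injective hc, AddMonoidAlgebra.coeff_injective hc'⟩

/-- The commutative algebra `K[κ, κ⁻¹, C]`, which serves as the part of `U_q(sl₂)` generated by `k`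
and the Casimir element; the basis vector at `(a, b)` is `κ ^ a * C ^ b`. -/
abbrev UqCartan (K : Type*) [Field K] := AddMonoidAlgebra K (ℤ × ℕ)

/-- The automorphism `κ ↦ q ^ (-2 * n) κ`, `C ↦ C` of `K[κ, κ⁻¹, C]`, as a linear map. -/
noncomputable def cartanTwist (q : K) (n : ℤ) : UqCartan K →ₗ[K] UqCartan K where
  toFun p := .ofCoeff (Finsupp.onFinset p.coeff.support
    (fun m => (q ^ (-2 * n)) ^ m.1 * p.coeff m) (by
      intro m hm
      rw [Finsupp.mem_support_iff]
      exact right_ne_zero_of_mul hm))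
  map_add' p r := by
    apply AddMonoidAlgebra.coeff_injective
    ext m
    simp [mul_add]
  map_smul' c p := by
    apply AddMonoidAlgebra.coeff_injective
    ext m
    simp [mul_left_comm]

theorem coeff_cartanTwist (q : K) (n : ℤ) (p : UqCartan K) (m : ℤ × ℕ) :
    (cartanTwist q n p).coeff m = (q ^ (-2 * n)) ^ m.1 * p.coeff m := rfl

theorem cartanTwist_single (q : K) (n : ℤ) (m : ℤ × ℕ) (c : K) :
    cartanTwist q n (AddMonoidAlgebra.single m c) =
      AddMonoidAlgebra.single m ((q ^ (-2 * n)) ^ m.1 * c) := by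
  classical
  apply AddMonoidAlgebra.coeff_injective
  ext l
  rw [coeff_cartanTwist, AddMonoidAlgebra.coeff_single, AddMonoidAlgebra.coeff_single,
    Finsupp.single_apply, Finsupp.single_apply]
  split_ifs with h
  · rw [h]
  · simp

theorem cartanTwist_zero (q : K) (p : UqCartan K) : cartanTwist q 0 p = p := by
  apply AddMonoidAlgebra.coeff_injective
  ext m
  simp [coeff_cartanTwist]

theorem cartanTwist_ne_zero {q : K} (hq0 : q ≠ 0) (n : ℤ) {p : UqCartan K} (hp : p ≠ 0) :
    cartanTwist q n p ≠ 0 := by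
  intro h
  apply hp
  apply AddMonoidAlgebra.coeff_injective
  ext m
  have := congrArg (fun r : UqCartan K => r.coeff m) h
  simp only [coeff_cartanTwist] at this
  exact (mul_eq_zero.mp this).resolve_left (zpow_ne_zero _ (zpow_ne_zero _ hq0))

/-- The operator `w_n ↦ c n • w_{n+j}` on the free `K[κ, κ⁻¹, C]`-module with basis
`w_n`, `n : ℤ`. -/
noncomputable def weightedShift (c : ℤ → UqCartan K) (j : ℤ) :
    Module.End (UqCartan K) (ℤ →₀ UqCartan K) :=
  Finsupp.linearCombination (UqCartan K) fun n => Finsupp.single (n + j) (c n)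

theorem weightedShift_single (c : ℤ → UqCartan K) (j n : ℤ) (r : UqCartan K) :
    weightedShift c j (Finsupp.single n r) = Finsupp.single (n + j) (r * c n) := by
  simp [weightedShift]

/-- The coefficient of `w_{n-1}` in `e w_n`. As `w_n = f w_{n-1}`, it is the value of `e f` on
`w_{n-1}`, which is determined by those of `k` and of the Casimir element. -/
noncomputable def raiseCoeff (q : K) (n : ℤ) : UqCartan K :=
  AddMonoidAlgebra.single (0, 1) 1 -
    ((q - q⁻¹)⁻¹ * (q - q⁻¹)⁻¹) • (AddMonoidAlgebra.single (1, 0) (q ^ (1 - 2 * n)) +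
      AddMonoidAlgebra.single (-1, 0) (q ^ (2 * n - 1)))

theorem raiseCoeff_ne_zero (q : K) (n : ℤ) : raiseCoeff q n ≠ 0 := by
  classical
  intro h
  have := congrArg (fun r : UqCartan K => r.coeff (0, 1)) h
  simp [raiseCoeff] at this

/-- The operators by which the generators act in the generic representation. -/
noncomputable def genericOp (q : K) : UqGen → Module.End (UqCartan K) (ℤ →₀ UqCartan K)
  | .k => weightedShift (fun n => AddMonoidAlgebra.single (1, 0) (q ^ (-2 * n))) 0
  | .kinv => weightedShift (fun n => AddMonoidAlgebra.single (-1, 0) (q ^ (2 * n))) 0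
  | .e => weightedShift (raiseCoeff q) (-1)
  | .f => weightedShift (fun _ => 1) 1

theorem sub_inv_ne_zero {q : K} (hq0 : q ≠ 0) (hq : ∀ n : ℕ, 0 < n → q ^ n ≠ 1) : q - q⁻¹ ≠ 0 := by
  rw [sub_ne_zero]
  intro h
  refine hq 2 two_pos ?_
  rw [pow_two]
  nth_rw 2 [h]
  exact mul_inv_cancel₀ hq0

theorem genericOp_rel {q : K} (hq0 : q ≠ 0) (hq1 : q - q⁻¹ ≠ 0) ⦃a b : FreeAlgebra K UqGen⦄
    (h : UqRel q a b) :
    FreeAlgebra.lift K (genericOp q) a = FreeAlgebra.lift K (genericOp q) b := by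
  cases h <;> simp only [map_mul, map_sub, map_smul, map_one, FreeAlgebra.lift_ι_apply] <;>
    refine Finsupp.lhom_ext fun n r => ?_
  · simp only [genericOp, Module.End.mul_apply, weightedShift_single, Module.End.one_apply,
      mul_assoc, AddMonoidAlgebra.single_mul_single, add_zero]
    rw [← zpow_add₀ hq0]
    simp [← Prod.zero_eq_mk, ← AddMonoidAlgebra.one_def]
  · simp only [genericOp, Module.End.mul_apply, weightedShift_single, Module.End.one_apply,
      mul_assoc, AddMonoidAlgebra.single_mul_single, add_zero]
    rw [← zpow_add₀ hq0]
    simp [← Prod.zero_eq_mk, ← AddMonoidAlgebra.one_def]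
  · simp only [genericOp, Module.End.mul_apply, weightedShift_single, LinearMap.smul_apply,
      add_zero, Finsupp.smul_single]
    congr 1
    rw [mul_assoc, mul_comm (raiseCoeff q n), ← mul_assoc, ← smul_mul_assoc,
      ← mul_smul_comm, AddMonoidAlgebra.smul_single, smul_eq_mul, ← zpow_ofNat, ← zpow_add₀ hq0]
    congr 4
    ring
  · simp only [genericOp, Module.End.mul_apply, weightedShift_single, LinearMap.smul_apply,
      add_zero, Finsupp.smul_single]
    congr 1
    rw [mul_one, mul_one, ← mul_smul_comm, AddMonoidAlgebra.smul_single, smul_eq_mul, ← zpow_ofNat,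
      ← zpow_neg, ← zpow_add₀ hq0]
    congr 3
    push_cast
    ring
  · simp only [genericOp, Module.End.mul_apply, weightedShift_single, LinearMap.smul_apply,
      LinearMap.sub_apply, add_zero, add_neg_cancel_right, neg_add_cancel_right, mul_one,
      ← Finsupp.single_sub, Finsupp.smul_single, ← mul_sub, ← mul_smul_comm]
    congr 2
    rw [raiseCoeff, raiseCoeff, sub_sub_sub_cancel_left, ← smul_sub, add_sub_add_comm,
      ← AddMonoidAlgebra.single_sub, ← AddMonoidAlgebra.single_sub, mul_smul, smul_add,
      AddMonoidAlgebra.smul_single, AddMonoidAlgebra.smul_single, sub_eq_add_neg (AddMonoidAlgebra.single _ _),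
      ← AddMonoidAlgebra.single_neg]
    congr 3 <;> rw [smul_eq_mul, inv_mul_eq_iff_eq_mul₀ hq1]
    · rw [show 1 - 2 * n = 1 + (-2 * n) by ring, show 1 - 2 * (n + 1) = -1 + (-2 * n) by ring,
        zpow_add₀ hq0, zpow_add₀ hq0, zpow_neg_one, zpow_one]
      ring
    · rw [show 2 * n - 1 = -1 + 2 * n by ring, show 2 * (n + 1) - 1 = 1 + 2 * n by ring,
        zpow_add₀ hq0, zpow_add₀ hq0, zpow_neg_one, zpow_one]
      ring

/-- The generic representation of `U_q(sl₂)`, a Verma module with a generic weight `κ`, extended to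
all integer degrees. Its basis vectors `w_n`, `n : ℤ`, are permuted by `f`, they are eigenvectors
of `k` for `q ^ (-2 * n) κ`, and the Casimir element acts as the indeterminate `C`. -/
noncomputable def genericRep {q : K} (hq0 : q ≠ 0) (hq1 : q - q⁻¹ ≠ 0) :
    UqSl2 q →ₐ[K] Module.End (UqCartan K) (ℤ →₀ UqCartan K) :=
  RingQuot.liftAlgHom K (s := UqRel q) ⟨FreeAlgebra.lift K (genericOp q), genericOp_rel hq0 hq1⟩

theorem genericRep_gen {q : K} (hq0 : q ≠ 0) (hq1 : q - q⁻¹ ≠ 0) (g : UqGen) :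
    genericRep hq0 hq1 (uqGen q g) = genericOp q g := by
  rw [genericRep, uqGen, RingQuot.liftAlgHom_mkAlgHom_apply, FreeAlgebra.lift_ι_apply]

theorem uqCounit_gen (q : K) (g : UqGen) : uqCounit q (uqGen q g) = uqTrivialValue K g := by
  rw [uqCounit, uqGen, RingQuot.liftAlgHom_mkAlgHom_apply, FreeAlgebra.lift_ι_apply]

theorem uq_k_mul_kinv (q : K) : uqGen q .k * uqGen q .kinv = 1 := by
  simpa [uqGen] using RingQuot.mkAlgHom_rel K (UqRel.k_kinv (q := q))

theorem uq_kinv_mul_k (q : K) : uqGen q .kinv * uqGen q .k = 1 := by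
  simpa [uqGen] using RingQuot.mkAlgHom_rel K (UqRel.kinv_k (q := q))

theorem uq_k_mul_e (q : K) : uqGen q .k * uqGen q .e = q ^ 2 • (uqGen q .e * uqGen q .k) := by
  simpa [uqGen] using RingQuot.mkAlgHom_rel K (UqRel.k_e (q := q))

theorem uq_k_mul_f (q : K) : uqGen q .k * uqGen q .f = (q ^ 2)⁻¹ • (uqGen q .f * uqGen q .k) := by
  simpa [uqGen] using RingQuot.mkAlgHom_rel K (UqRel.k_f (q := q))

theorem uq_e_mul_f (q : K) : uqGen q .e * uqGen q .f - uqGen q .f * uqGen q .e =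
    (q - q⁻¹)⁻¹ • (uqGen q .k - uqGen q .kinv) := by
  simpa [uqGen] using RingQuot.mkAlgHom_rel K (UqRel.e_f (q := q))

/-- The generator `k` as a unit. -/
noncomputable def uqUnitK (q : K) : (UqSl2 q)ˣ :=
  ⟨uqGen q .k, uqGen q .kinv, uq_k_mul_kinv q, uq_kinv_mul_k q⟩

theorem uq_kinv_mul_of_k_mul {q c : K} (hc : c ≠ 0) {u : UqSl2 q}
    (h : uqGen q .k * u = c • (u * uqGen q .k)) :
    uqGen q .kinv * u = c⁻¹ • (u * uqGen q .kinv) := by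
  have h2 := congrArg (fun s => c⁻¹ • (uqGen q .kinv * s * uqGen q .kinv)) h
  rw [← mul_assoc, uq_kinv_mul_k, one_mul, mul_smul_comm, smul_mul_assoc, smul_smul,
    inv_mul_cancel₀ hc, one_smul, mul_assoc, mul_assoc, uq_k_mul_kinv, mul_one] at h2
  exact h2.symm

theorem uq_kinv_mul_e {q : K} (hq0 : q ≠ 0) :
    uqGen q .kinv * uqGen q .e = (q ^ 2)⁻¹ • (uqGen q .e * uqGen q .kinv) :=
  uq_kinv_mul_of_k_mul (pow_ne_zero 2 hq0) (uq_k_mul_e q)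

theorem uq_kinv_mul_f {q : K} (hq0 : q ≠ 0) :
    uqGen q .kinv * uqGen q .f = q ^ 2 • (uqGen q .f * uqGen q .kinv) := by
  simpa using uq_kinv_mul_of_k_mul (inv_ne_zero (pow_ne_zero 2 hq0)) (uq_k_mul_f q)

/-- The Casimir element of `U_q(sl₂)`. -/
noncomputable def uqCasimir (q : K) : UqSl2 q :=
  uqGen q .f * uqGen q .e +
    ((q - q⁻¹)⁻¹ * (q - q⁻¹)⁻¹) • (q • uqGen q .k + q⁻¹ • uqGen q .kinv)

theorem uqCasimir_commute_k {q : K} (hq0 : q ≠ 0) : Commute (uqGen q .k) (uqCasimir q) := by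
  have h : uqGen q .k * (uqGen q .f * uqGen q .e) = uqGen q .f * uqGen q .e * uqGen q .k := by
    rw [← mul_assoc, uq_k_mul_f, smul_mul_assoc, mul_assoc, uq_k_mul_e, mul_smul_comm, smul_smul,
      inv_mul_cancel₀ (pow_ne_zero 2 hq0), one_smul, mul_assoc]
  unfold Commute SemiconjBy uqCasimir
  rw [mul_add, add_mul, h, mul_smul_comm, smul_mul_assoc, mul_add, add_mul, mul_smul_comm,
    mul_smul_comm, smul_mul_assoc, smul_mul_assoc, uq_k_mul_kinv, uq_kinv_mul_k]

theorem uqCasimir_eq {q : K} (hq0 : q ≠ 0) (hq1 : q - q⁻¹ ≠ 0) :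
    uqCasimir q = uqGen q .e * uqGen q .f +
      ((q - q⁻¹)⁻¹ * (q - q⁻¹)⁻¹) • (q⁻¹ • uqGen q .k + q • uqGen q .kinv) := by
  rw [sub_eq_iff_eq_add.mp (uq_e_mul_f q), uqCasimir]
  match_scalars <;> field_simp <;> ring

theorem uqCasimir_commute_f {q : K} (hq0 : q ≠ 0) (hq1 : q - q⁻¹ ≠ 0) :
    Commute (uqGen q .f) (uqCasimir q) := by
  unfold Commute SemiconjBy
  nth_rw 1 [uqCasimir_eq hq0 hq1]
  rw [uqCasimir, mul_add, add_mul, mul_assoc, mul_smul_comm, smul_mul_assoc, mul_add, add_mul,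
    mul_smul_comm, mul_smul_comm, smul_mul_assoc, smul_mul_assoc, uq_k_mul_f, uq_kinv_mul_f hq0]
  match_scalars <;> field_simp

theorem uqCasimir_commute_e {q : K} (hq0 : q ≠ 0) (hq1 : q - q⁻¹ ≠ 0) :
    Commute (uqGen q .e) (uqCasimir q) := by
  unfold Commute SemiconjBy
  nth_rw 2 [uqCasimir_eq hq0 hq1]
  rw [uqCasimir, mul_add, add_mul, mul_assoc, mul_smul_comm, smul_mul_assoc, mul_add, add_mul,
    mul_smul_comm, mul_smul_comm, smul_mul_assoc, smul_mul_assoc, uq_k_mul_e, uq_kinv_mul_e hq0]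
  match_scalars <;> field_simp

/-- The map `K[κ, κ⁻¹, C] → U_q(sl₂)` which sends `κ` to `k` and `C` to the Casimir element. -/
noncomputable def cartanHom {q : K} (hq0 : q ≠ 0) : UqCartan K →ₐ[K] UqSl2 q :=
  AddMonoidAlgebra.lift K (UqSl2 q) (ℤ × ℕ)
    { toFun := fun m => ((uqUnitK q ^ m.toAdd.1 : (UqSl2 q)ˣ) : UqSl2 q) * uqCasimir q ^ m.toAdd.2
      map_one' := by simp
      map_mul' := fun m l => by
        have h : Commute (uqCasimir q ^ m.toAdd.2)
            ((uqUnitK q ^ l.toAdd.1 : (UqSl2 q)ˣ) : UqSl2 q) :=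
          ((Commute.units_zpow_right (u := uqUnitK q) (uqCasimir_commute_k hq0).symm _).pow_left _)
        rw [toAdd_mul, Prod.fst_add, Prod.snd_add, zpow_add, pow_add, Units.val_mul, mul_assoc,
          mul_assoc, ← mul_assoc _ _ (uqCasimir q ^ _), ← h.eq, mul_assoc] }

theorem cartanHom_single {q : K} (hq0 : q ≠ 0) (m : ℤ × ℕ) (c : K) :
    cartanHom hq0 (AddMonoidAlgebra.single m c) =
      c • (((uqUnitK q ^ m.1 : (UqSl2 q)ˣ) : UqSl2 q) * uqCasimir q ^ m.2) := by
  rw [cartanHom, AddMonoidAlgebra.lift_single]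
  rfl

/-- The monomials `f ^ n` in degree `n` and `e ^ n` in degree `-n`. -/
noncomputable def uqMonomial (q : K) : ℤ → UqSl2 q
  | Int.ofNat n => uqGen q .f ^ n
  | Int.negSucc n => uqGen q .e ^ (n + 1)

theorem cartanHom_kappa {q : K} (hq0 : q ≠ 0) (c : K) :
    cartanHom hq0 (AddMonoidAlgebra.single (1, 0) c) = c • uqGen q .k := by
  simp [cartanHom_single, uqUnitK]

theorem cartanHom_kappa_inv {q : K} (hq0 : q ≠ 0) (c : K) :
    cartanHom hq0 (AddMonoidAlgebra.single (-1, 0) c) = c • uqGen q .kinv := by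
  simp [cartanHom_single, uqUnitK]

theorem cartanHom_casimir {q : K} (hq0 : q ≠ 0) :
    cartanHom hq0 (AddMonoidAlgebra.single (0, 1) 1) = uqCasimir q := by
  simp [cartanHom_single]

theorem mul_pow_eq_smul {A : Type*} [Ring A] [Algebra K A] {a b : A} {c : K}
    (h : a * b = c • (b * a)) (n : ℕ) : a * b ^ n = c ^ n • (b ^ n * a) := by
  induction n with
  | zero => simp
  | succ n ih =>
    rw [pow_succ, ← mul_assoc, ih, smul_mul_assoc, mul_assoc, h, mul_smul_comm, smul_smul,
      pow_succ, mul_assoc]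

/-- The elements `uqMonomial q j * p` with `p` in the image of `K[κ, κ⁻¹, C]` are stable under left
multiplication by the generators. -/
theorem exists_gen_mul_uqMonomial {q : K} (hq0 : q ≠ 0) (hq1 : q - q⁻¹ ≠ 0) (g : UqGen) (j : ℤ) :
    ∃ (j' : ℤ) (r : UqCartan K),
      uqGen q g * uqMonomial q j = uqMonomial q j' * cartanHom hq0 r := by
  have hfe : uqGen q .f * uqGen q .e = uqCasimir q -
      ((q - q⁻¹)⁻¹ * (q - q⁻¹)⁻¹) • (q • uqGen q .k + q⁻¹ • uqGen q .kinv) := by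
    rw [uqCasimir, add_sub_cancel_right]
  have hef : uqGen q .e * uqGen q .f = uqCasimir q -
      ((q - q⁻¹)⁻¹ * (q - q⁻¹)⁻¹) • (q⁻¹ • uqGen q .k + q • uqGen q .kinv) := by
    rw [uqCasimir_eq hq0 hq1, add_sub_cancel_right]
  -- `f e` and `e f` lie in the image of `K[κ, κ⁻¹, C]`, and can be moved past powers of `e` and `f`.
  have move : ∀ (b : UqSl2 q) (s t α β : K), uqGen q .k * b = s • (b * uqGen q .k) →
      uqGen q .kinv * b = t • (b * uqGen q .kinv) → Commute b (uqCasimir q) → ∀ n : ℕ,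
      ∃ r, (uqCasimir q - ((q - q⁻¹)⁻¹ * (q - q⁻¹)⁻¹) •
        (α • uqGen q .k + β • uqGen q .kinv)) * b ^ n = b ^ n * cartanHom hq0 r := by
    intro b s t α β hs ht hc n
    refine ⟨AddMonoidAlgebra.single (0, 1) 1 - ((q - q⁻¹)⁻¹ * (q - q⁻¹)⁻¹) •
      (AddMonoidAlgebra.single (1, 0) (α * s ^ n) +
        AddMonoidAlgebra.single (-1, 0) (β * t ^ n)), ?_⟩
    rw [map_sub, map_smul, map_add, cartanHom_casimir, cartanHom_kappa, cartanHom_kappa_inv,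
      sub_mul, smul_mul_assoc, add_mul, smul_mul_assoc, smul_mul_assoc, mul_pow_eq_smul hs,
      mul_pow_eq_smul ht, ← (hc.pow_left n).eq]
    simp only [mul_sub, mul_add, mul_smul_comm, smul_smul]
  match g, j with
  | .k, Int.ofNat n =>
    refine ⟨Int.ofNat n, AddMonoidAlgebra.single (1, 0) (((q ^ 2)⁻¹) ^ n), ?_⟩
    rw [cartanHom_kappa, uqMonomial, mul_pow_eq_smul (uq_k_mul_f q), mul_smul_comm]
  | .k, Int.negSucc n =>
    refine ⟨Int.negSucc n, AddMonoidAlgebra.single (1, 0) ((q ^ 2) ^ (n + 1)), ?_⟩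
    rw [cartanHom_kappa, uqMonomial, mul_pow_eq_smul (uq_k_mul_e q), mul_smul_comm]
  | .kinv, Int.ofNat n =>
    refine ⟨Int.ofNat n, AddMonoidAlgebra.single (-1, 0) ((q ^ 2) ^ n), ?_⟩
    rw [cartanHom_kappa_inv, uqMonomial, mul_pow_eq_smul (uq_kinv_mul_f hq0), mul_smul_comm]
  | .kinv, Int.negSucc n =>
    refine ⟨Int.negSucc n, AddMonoidAlgebra.single (-1, 0) (((q ^ 2)⁻¹) ^ (n + 1)), ?_⟩
    rw [cartanHom_kappa_inv, uqMonomial, mul_pow_eq_smul (uq_kinv_mul_e hq0), mul_smul_comm]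
  | .f, Int.ofNat n =>
    refine ⟨Int.ofNat (n + 1), 1, ?_⟩
    rw [map_one, mul_one, uqMonomial, uqMonomial, pow_succ']
  | .f, Int.negSucc n =>
    obtain ⟨r, hr⟩ := move _ _ _ q q⁻¹ (uq_k_mul_e q) (uq_kinv_mul_e hq0)
      (uqCasimir_commute_e hq0 hq1) n
    refine ⟨-n, r, ?_⟩
    have h : uqMonomial q (-n) = uqGen q .e ^ n := by
      cases n with
      | zero => exact (pow_zero (uqGen q .f)).trans (pow_zero _).symm
      | succ n => rfl
    rw [h, ← hr, ← hfe, uqMonomial, pow_succ', mul_assoc]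
  | .e, Int.ofNat 0 =>
    refine ⟨Int.negSucc 0, 1, ?_⟩
    simp [uqMonomial]
  | .e, Int.ofNat (n + 1) =>
    obtain ⟨r, hr⟩ := move _ _ _ q⁻¹ q (uq_k_mul_f q) (uq_kinv_mul_f hq0)
      (uqCasimir_commute_f hq0 hq1) n
    refine ⟨Int.ofNat n, r, ?_⟩
    rw [uqMonomial, uqMonomial, ← hr, ← hef, pow_succ', mul_assoc]
  | .e, Int.negSucc n =>
    refine ⟨Int.negSucc (n + 1), 1, ?_⟩
    rw [map_one, mul_one, uqMonomial, uqMonomial, ← pow_succ']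

/-- Half of a Poincaré–Birkhoff–Witt theorem: `U_q(sl₂)` is spanned by the elements `f ^ n * p` and
`e ^ n * p` with `p` a polynomial in `k`, `k⁻¹` and the Casimir element. -/
theorem exists_finsupp_sum_uqMonomial {q : K} (hq0 : q ≠ 0) (hq1 : q - q⁻¹ ≠ 0) (u : UqSl2 q) :
    ∃ P : ℤ →₀ UqCartan K, u = P.sum fun j p => uqMonomial q j * cartanHom hq0 p := by
  let Φ : (ℤ →₀ UqCartan K) →ₗ[K] UqSl2 q :=
    Finsupp.lsum K fun j => (LinearMap.mulLeft K (uqMonomial q j)).comp (cartanHom hq0).toLinearMap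
  have hΦ : ∀ j p, Φ (Finsupp.single j p) = uqMonomial q j * cartanHom hq0 p := by
    intro j p
    simp [Φ]
  suffices h : u ∈ LinearMap.range Φ by
    obtain ⟨P, rfl⟩ := h
    exact ⟨P, rfl⟩
  have hgen : ∀ g, ∀ s ∈ LinearMap.range Φ, uqGen q g * s ∈ LinearMap.range Φ := by
    rintro g _ ⟨P, rfl⟩
    induction P using Finsupp.induction_linear with
    | zero => simp
    | add P Q hP hQ => rw [map_add, mul_add]; exact add_mem hP hQ
    | single j p =>
      obtain ⟨j', r, h⟩ := exists_gen_mul_uqMonomial hq0 hq1 g j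
      rw [hΦ, ← mul_assoc, h, mul_assoc, ← map_mul, ← hΦ]
      exact ⟨_, rfl⟩
  have hone : (1 : UqSl2 q) ∈ LinearMap.range Φ := by
    refine ⟨Finsupp.single (Int.ofNat 0) 1, ?_⟩
    rw [hΦ, map_one, uqMonomial, pow_zero, mul_one]
  obtain ⟨a, rfl⟩ := RingQuot.mkAlgHom_surjective K (UqRel q) u
  have key : ∀ s ∈ LinearMap.range Φ, RingQuot.mkAlgHom K (UqRel q) a * s ∈ LinearMap.range Φ := by
    induction a using FreeAlgebra.induction with
    | grade0 c =>
      intro s hs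
      rw [AlgHom.commutes, ← Algebra.smul_def]
      exact Submodule.smul_mem _ _ hs
    | grade1 g => exact hgen g
    | mul a b ha hb =>
      intro s hs
      rw [map_mul, mul_assoc]
      exact ha _ (hb _ hs)
    | add a b ha hb =>
      intro s hs
      rw [map_add, add_mul]
      exact add_mem (ha _ hs) (hb _ hs)
  simpa using key 1 hone

theorem genericRep_apply_single {q : K} (hq0 : q ≠ 0) (hq1 : q - q⁻¹ ≠ 0) (u : UqSl2 q) (n : ℤ)
    (r : UqCartan K) : genericRep hq0 hq1 u (Finsupp.single n r) =
      r • genericRep hq0 hq1 u (Finsupp.single n 1) := by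
  rw [← map_smul, Finsupp.smul_single, smul_eq_mul, mul_one]

theorem genericRep_unitK {q : K} (hq0 : q ≠ 0) (hq1 : q - q⁻¹ ≠ 0) (a n : ℤ) (r : UqCartan K) :
    genericRep hq0 hq1 ((uqUnitK q ^ a : (UqSl2 q)ˣ) : UqSl2 q) (Finsupp.single n r) =
      Finsupp.single n (r * AddMonoidAlgebra.single (a, 0) ((q ^ (-2 * n)) ^ a)) := by
  have hz : q ^ (-2 * n) ≠ 0 := zpow_ne_zero _ hq0
  induction a generalizing r with
  | zero => simp [← Prod.zero_eq_mk, ← AddMonoidAlgebra.one_def]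
  | succ a ih =>
    rw [zpow_add_one, Units.val_mul, map_mul, Module.End.mul_apply,
      show ((uqUnitK q : (UqSl2 q)ˣ) : UqSl2 q) = uqGen q .k from rfl, genericRep_gen, genericOp,
      weightedShift_single, add_zero, ih, mul_assoc, AddMonoidAlgebra.single_mul_single,
      zpow_add_one₀ hz, mul_comm (q ^ (-2 * n))]
    simp [add_comm]
  | pred a ih =>
    rw [zpow_sub_one, Units.val_mul, map_mul, Module.End.mul_apply,
      show (((uqUnitK q)⁻¹ : (UqSl2 q)ˣ) : UqSl2 q) = uqGen q .kinv from rfl, genericRep_gen,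
      genericOp, weightedShift_single, add_zero, ih, mul_assoc, AddMonoidAlgebra.single_mul_single,
      zpow_sub_one₀ hz, mul_comm (q ^ (2 * n)), ← zpow_neg, neg_mul, neg_neg]
    simp [add_comm, sub_eq_add_neg]

theorem genericRep_casimir {q : K} (hq0 : q ≠ 0) (hq1 : q - q⁻¹ ≠ 0) (n : ℤ) (r : UqCartan K) :
    genericRep hq0 hq1 (uqCasimir q) (Finsupp.single n r) =
      Finsupp.single n (r * AddMonoidAlgebra.single (0, 1) 1) := by
  have h1 : q • (AddMonoidAlgebra.single (1, 0) (q ^ (-2 * n)) : UqCartan K) =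
      AddMonoidAlgebra.single (1, 0) (q ^ (1 - 2 * n)) := by
    rw [AddMonoidAlgebra.smul_single, smul_eq_mul, sub_eq_add_neg, zpow_add₀ hq0, zpow_one, neg_mul]
  have h2 : q⁻¹ • (AddMonoidAlgebra.single (-1, 0) (q ^ (2 * n)) : UqCartan K) =
      AddMonoidAlgebra.single (-1, 0) (q ^ (2 * n - 1)) := by
    rw [AddMonoidAlgebra.smul_single, smul_eq_mul, sub_eq_add_neg, zpow_add₀ hq0, zpow_neg_one,
      mul_comm]
  simp only [uqCasimir, map_add, map_mul, map_smul, genericRep_gen, genericOp,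
    LinearMap.add_apply, LinearMap.smul_apply, Module.End.mul_apply, weightedShift_single,
    add_zero, neg_add_cancel_right, mul_one, Finsupp.smul_single, ← Finsupp.single_add]
  congr 1
  rw [← mul_smul_comm q, ← mul_smul_comm q⁻¹, h1, h2, ← mul_add, ← mul_smul_comm, ← mul_add,
    raiseCoeff, sub_add_cancel]

theorem genericRep_cartanHom {q : K} (hq0 : q ≠ 0) (hq1 : q - q⁻¹ ≠ 0) (p : UqCartan K) (n : ℤ)
    (r : UqCartan K) : genericRep hq0 hq1 (cartanHom hq0 p) (Finsupp.single n r) =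
      Finsupp.single n (r * cartanTwist q n p) := by
  have hC : ∀ (b : ℕ) (r : UqCartan K),
      genericRep hq0 hq1 (uqCasimir q ^ b) (Finsupp.single n r) =
        Finsupp.single n (r * AddMonoidAlgebra.single (0, b) 1) := by
    intro b
    induction b with
    | zero => intro r; simp [← Prod.zero_eq_mk, ← AddMonoidAlgebra.one_def]
    | succ b ih =>
      intro r
      rw [pow_succ, map_mul, Module.End.mul_apply, genericRep_casimir, ih, mul_assoc,
        AddMonoidAlgebra.single_mul_single]
      simp [add_comm]
  induction p using AddMonoidAlgebra.induction_linear with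
  | zero => simp
  | add p p' hp hp' =>
    rw [map_add, map_add, LinearMap.add_apply, hp, hp', map_add, mul_add, Finsupp.single_add]
  | single m c =>
    rw [cartanHom_single, map_smul, LinearMap.smul_apply, map_mul, Module.End.mul_apply, hC,
      genericRep_unitK, cartanTwist_single, mul_assoc, AddMonoidAlgebra.single_mul_single,
      Finsupp.smul_single, ← mul_smul_comm, AddMonoidAlgebra.smul_single]
    simp [mul_comm]

theorem exists_genericRep_uqMonomial {q : K} (hq0 : q ≠ 0) (hq1 : q - q⁻¹ ≠ 0) (j n : ℤ) :
    ∃ c : UqCartan K, c ≠ 0 ∧ genericRep hq0 hq1 (uqMonomial q j) (Finsupp.single n 1) =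
      Finsupp.single (n + j) c := by
  have hpow : ∀ (g : UqGen) (s : ℤ) (γ : ℤ → UqCartan K), (∀ n, γ n ≠ 0) →
      genericOp q g = weightedShift γ s → ∀ m : ℕ, ∃ c : UqCartan K, c ≠ 0 ∧
        genericRep hq0 hq1 (uqGen q g ^ m) (Finsupp.single n 1) =
          Finsupp.single (n + m * s) c := by
    intro g s γ hγ hg m
    induction m with
    | zero => exact ⟨1, one_ne_zero, by simp⟩
    | succ m ih =>
      obtain ⟨c, hc, h⟩ := ih
      refine ⟨c * γ (n + m * s), mul_ne_zero hc (hγ _), ?_⟩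
      rw [pow_succ', map_mul, Module.End.mul_apply, h, genericRep_gen, hg, weightedShift_single]
      congr 1
      push_cast
      ring
  cases j with
  | ofNat m =>
    obtain ⟨c, hc, h⟩ := hpow .f 1 (fun _ => 1) (fun _ => one_ne_zero) rfl m
    exact ⟨c, hc, by rw [uqMonomial, h, mul_one]; rfl⟩
  | negSucc m =>
    obtain ⟨c, hc, h⟩ := hpow .e (-1) (raiseCoeff q) (raiseCoeff_ne_zero q) rfl (m + 1)
    refine ⟨c, hc, ?_⟩
    rw [uqMonomial, h, Int.negSucc_eq]
    push_cast
    rw [mul_neg_one]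

theorem uqCounit_uqMonomial (q : K) {j : ℤ} (hj : j ≠ 0) : uqCounit q (uqMonomial q j) = 0 := by
  match j with
  | Int.ofNat 0 => exact absurd rfl hj
  | Int.ofNat (n + 1) => simp [uqMonomial, uqCounit_gen, uqTrivialValue]
  | Int.negSucc n => simp [uqMonomial, uqCounit_gen, uqTrivialValue]

/-- Each term of an element `∑ j, uqMonomial q j * p j` shifts the basis of the generic
representation by its degree `j`. In a product equal to `1`, a degree which is attained by a single
pair of terms has a nonzero coefficient and hence vanishes; so both factors are homogeneous. -/
theorem exists_eq_uqMonomial_mul {q : K} (hq0 : q ≠ 0) (hq1 : q - q⁻¹ ≠ 0) {u v : UqSl2 q}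
    (huv : u * v = 1) : ∃ (a b : ℤ) (p r : UqCartan K),
      u = uqMonomial q a * cartanHom hq0 p ∧ v = uqMonomial q b * cartanHom hq0 r := by
  classical
  obtain ⟨P, hP⟩ := exists_finsupp_sum_uqMonomial hq0 hq1 u
  obtain ⟨Q, hQ⟩ := exists_finsupp_sum_uqMonomial hq0 hq1 v
  choose g hg0 hg using exists_genericRep_uqMonomial hq0 hq1
  have term : ∀ (j n : ℤ) (p s : UqCartan K),
      genericRep hq0 hq1 (uqMonomial q j * cartanHom hq0 p) (Finsupp.single n s) =
        Finsupp.single (n + j) (s * cartanTwist q n p * g j n) := by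
    intro j n p s
    rw [map_mul, Module.End.mul_apply, genericRep_cartanHom, genericRep_apply_single, hg,
      Finsupp.smul_single, smul_eq_mul]
  have hsum : ∑ j ∈ Q.support, ∑ i ∈ P.support,
      Finsupp.single (0 + j + i) (1 * cartanTwist q 0 (Q j) * g j 0 *
        cartanTwist q (0 + j) (P i) * g i (0 + j)) = Finsupp.single (0 : ℤ) (1 : UqCartan K) := by
    have hv : genericRep hq0 hq1 v (Finsupp.single 0 1) = ∑ j ∈ Q.support,
        Finsupp.single (0 + j) (1 * cartanTwist q 0 (Q j) * g j 0) := by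
      rw [hQ, Finsupp.sum, map_sum, LinearMap.sum_apply]
      exact Finset.sum_congr rfl fun j _ => term _ _ _ _
    have h := LinearMap.congr_fun (congrArg (genericRep hq0 hq1) huv)
      (Finsupp.single (0 : ℤ) (1 : UqCartan K))
    rw [map_mul, map_one, Module.End.mul_apply, Module.End.one_apply, hv, map_sum] at h
    rw [← h]
    refine Finset.sum_congr rfl fun j _ => ?_
    rw [hP, Finsupp.sum, map_sum, LinearMap.sum_apply]
    exact Finset.sum_congr rfl fun i _ => (term _ _ _ _).symm
  have key : ∀ x ∈ Q.support ×ˢ P.support, UniqueAdd Q.support P.support x.1 x.2 →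
      x.1 + x.2 = 0 := by
    rintro ⟨j, i⟩ hx hu
    rw [Finset.mem_product] at hx
    by_contra hne
    have h := DFunLike.congr_fun hsum (j + i)
    rw [Finsupp.finsetSum_apply, Finset.sum_eq_single j, Finsupp.finsetSum_apply,
      Finset.sum_eq_single i, zero_add, Finsupp.single_eq_same,
      Finsupp.single_eq_of_ne hne] at h
    · have hj := cartanTwist_ne_zero hq0 0 (Finsupp.mem_support_iff.mp hx.1)
      have hi := cartanTwist_ne_zero hq0 j (Finsupp.mem_support_iff.mp hx.2)
      exact mul_ne_zero (mul_ne_zero (mul_ne_zero (mul_ne_zero one_ne_zero hj) (hg0 _ _)) hi)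
        (hg0 _ _) h
    · intro i' hi' hii
      refine Finsupp.single_eq_of_ne fun h => hii ?_
      rw [zero_add] at h
      exact (hu hx.1 hi' h.symm).2
    · exact fun h => absurd hx.2 h
    · intro j' hj' hjj
      rw [Finsupp.finsetSum_apply]
      refine Finset.sum_eq_zero fun i' hi' => Finsupp.single_eq_of_ne fun h => hjj ?_
      rw [zero_add] at h
      exact (hu hj' hi' h.symm).1
    · exact fun h => absurd hx.1 h
  have hne : ¬ Q.support = ∅ ∧ ¬ P.support = ∅ := by
    constructor <;> intro h <;> rw [h] at hsum <;>
      simp only [Finset.sum_empty, Finset.sum_const_zero] at hsum <;>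
      exact Finsupp.single_ne_zero.mpr one_ne_zero hsum.symm
  rw [← ne_eq, ← ne_eq, ← Finset.nonempty_iff_ne_empty, ← Finset.nonempty_iff_ne_empty] at hne
  have hcard : ¬ 1 < Q.support.card * P.support.card := by
    intro hlt
    obtain ⟨p1, hp1, p2, hp2, hne12, hu1, hu2⟩ := TwoUniqueSums.uniqueAdd_of_one_lt_card hlt
    have e := (key p2 hp2 hu2).trans (key p1 hp1 hu1).symm
    rw [Finset.mem_product] at hp2
    have h12 := hu1 hp2.1 hp2.2 e
    exact hne12 (Prod.ext h12.1.symm h12.2.symm)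
  have h1 := hne.1.card_pos
  have h2 := hne.2.card_pos
  obtain ⟨b, r, rfl⟩ := Finsupp.card_support_le_one'.mp
    (show Q.support.card ≤ 1 by nlinarith)
  obtain ⟨a, p, rfl⟩ := Finsupp.card_support_le_one'.mp
    (show P.support.card ≤ 1 by nlinarith)
  exact ⟨a, b, p, r, by rw [hP, Finsupp.sum_single_index (by simp)],
    by rw [hQ, Finsupp.sum_single_index (by simp)]⟩

/-- The units of `U_q(sl₂)` are the nonzero multiples of the powers of `k`. A homogeneous unit has
degree `0` because the counit kills `e` and `f`, so it comes from a unit of `K[κ, κ⁻¹, C]`. -/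
theorem exists_eq_smul_zpow_of_isUnit {q : K} (hq0 : q ≠ 0) (hq1 : q - q⁻¹ ≠ 0) {u : UqSl2 q}
    (hu : IsUnit u) : ∃ (c : K) (n : ℤ), u = c • ((uqUnitK q ^ n : (UqSl2 q)ˣ) : UqSl2 q) := by
  obtain ⟨v, huv⟩ := hu.exists_right_inv
  obtain ⟨a, b, p, r, rfl, rfl⟩ := exists_eq_uqMonomial_mul hq0 hq1 huv
  have hε := congrArg (uqCounit q) huv
  rw [map_mul, map_mul, map_mul, map_one] at hε
  have ha : a = 0 := by
    by_contra ha
    rw [uqCounit_uqMonomial q ha] at hε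
    simp at hε
  have hb : b = 0 := by
    by_contra hb
    rw [uqCounit_uqMonomial q hb] at hε
    simp at hε
  subst ha hb
  have h0 : uqMonomial q 0 = 1 := pow_zero _
  rw [h0, one_mul, one_mul, ← map_mul] at huv
  have hpr : p * r = 1 := by
    have h := LinearMap.congr_fun (congrArg (genericRep hq0 hq1) huv)
      (Finsupp.single (0 : ℤ) (1 : UqCartan K))
    rw [genericRep_cartanHom, map_one, Module.End.one_apply, one_mul, cartanTwist_zero] at h
    exact Finsupp.single_injective _ h
  obtain ⟨m, m', c, c', rfl, rfl⟩ := exists_eq_single_of_mul_eq_one hpr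
  rw [AddMonoidAlgebra.single_mul_single, AddMonoidAlgebra.one_def,
    AddMonoidAlgebra.single_inj] at hpr
  have hm : m.2 = 0 := by
    rcases hpr with h | h
    · have := congrArg Prod.snd h.1
      simp only [Prod.snd_add, Prod.snd_zero] at this
      omega
    · exact absurd h.2 one_ne_zero
  refine ⟨c, m.1, ?_⟩
  rw [h0, one_mul, cartanHom_single, hm, pow_zero, mul_one]

end UnitsOfUq

/-! ### Equitable triples in `sl₂` -/

section EquitableTriplesInSl2

variable {K : Type*} [Field K]

/-- The element `a h + b e + c f` of `sl₂`. -/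
def sl2Mk (a b c : K) : Sl2 K :=
  ⟨!![a, b; c, -a], by
    exact (Matrix.trace_fin_two_of a b c (-a)).trans (add_neg_cancel a)⟩

theorem sl2Mk_val (a b c : K) : (sl2Mk a b c).val = !![a, b; c, -a] := rfl

theorem exists_eq_sl2Mk (X : Sl2 K) : ∃ a b c, X = sl2Mk a b c := by
  have h : X.val.trace = 0 := X.2
  rw [Matrix.trace_fin_two] at h
  refine ⟨X.val 0 0, X.val 0 1, X.val 1 0, Subtype.ext ?_⟩
  rw [sl2Mk_val, ← eq_neg_of_add_eq_zero_right h]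
  exact Matrix.eta_fin_two X.val

theorem sl2H_eq : sl2H K = sl2Mk 1 0 0 := by
  apply Subtype.ext
  rw [sl2H, LieAlgebra.SpecialLinear.val_singleSubSingle, sl2Mk_val]
  ext i j
  fin_cases i <;> fin_cases j <;> simp [Matrix.single]

theorem sl2Mk_lie (a b c a' b' c' : K) : ⁅sl2Mk a b c, sl2Mk a' b' c'⁆ =
    sl2Mk (b * c' - b' * c) (2 * (a * b' - a' * b)) (2 * (c * a' - c' * a)) := by
  apply Subtype.ext
  change (sl2Mk a b c).val * (sl2Mk a' b' c').val - (sl2Mk a' b' c').val * (sl2Mk a b c).val = _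
  simp only [sl2Mk_val]
  ext i j
  fin_cases i <;> fin_cases j <;> simp <;> ring

theorem sl2Mk_add (a b c a' b' c' : K) :
    sl2Mk a b c + sl2Mk a' b' c' = sl2Mk (a + a') (b + b') (c + c') := by
  apply Subtype.ext
  change (sl2Mk a b c).val + (sl2Mk a' b' c').val = _
  simp only [sl2Mk_val]
  ext i j
  fin_cases i <;> fin_cases j <;> simp [add_comm]

theorem sl2Mk_smul (s a b c : K) : s • sl2Mk a b c = sl2Mk (s * a) (s * b) (s * c) := by
  apply Subtype.ext
  change s • (sl2Mk a b c).val = _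
  simp only [sl2Mk_val]
  ext i j
  fin_cases i <;> fin_cases j <;> simp

theorem sl2Mk_neg (a b c : K) : -sl2Mk a b c = sl2Mk (-a) (-b) (-c) := by
  rw [← neg_one_smul K, sl2Mk_smul]
  simp

theorem sl2Mk_inj {a b c a' b' c' : K} (h : sl2Mk a b c = sl2Mk a' b' c') :
    a = a' ∧ b = b' ∧ c = c' := by
  have h' : (sl2Mk a b c).val = (sl2Mk a' b' c').val := congrArg Subtype.val h
  rw [sl2Mk_val, sl2Mk_val] at h'
  exact ⟨congrFun (congrFun h' 0) 0, congrFun (congrFun h' 0) 1, congrFun (congrFun h' 1) 0⟩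

/-- If `⁅X, N⁆ = 2 N` and `N ≠ 0` then `X` has the eigenvalues `1, -1` in the natural
representation: `X N = N`, while `X ^ 2` is a scalar. -/
theorem sl2_discriminant_eq_one [CharZero K] {a b c p r s : K}
    (h : ⁅sl2Mk a b c, sl2Mk p r s⁆ = (2 : K) • sl2Mk p r s) (h0 : sl2Mk p r s ≠ 0) :
    a * a + b * c = 1 := by
  rw [sl2Mk_lie, sl2Mk_smul] at h
  obtain ⟨h1, h2, h3⟩ := sl2Mk_inj h
  have h2 := mul_left_cancel₀ two_ne_zero h2
  have h3 := mul_left_cancel₀ two_ne_zero h3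
  have h4 : a * p + b * s = p := by
    refine mul_left_cancel₀ (two_ne_zero (α := K)) ?_
    linear_combination (1 - a) * h1 - c * h2 - b * h3
  have h5 : c * r + a * p = -p := by linear_combination h4 - h1
  by_contra hne
  have hne := sub_ne_zero.mpr hne
  have hp : p = 0 := (mul_eq_zero.mp (show (a * a + b * c - 1) * p = 0 by
    linear_combination (a + 1) * h4 + b * h3)).resolve_left hne
  have hr : r = 0 := (mul_eq_zero.mp (show (a * a + b * c - 1) * r = 0 by
    linear_combination (a + 1) * h2 + b * h5)).resolve_left hne
  have hs : s = 0 := (mul_eq_zero.mp (show (a * a + b * c - 1) * s = 0 by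
    linear_combination c * h4 + (1 - a) * h3)).resolve_left hne
  apply h0
  rw [hp, hr, hs]
  simpa using sl2Mk_smul (0 : K) 0 0 0 |>.symm

/-- Every element with eigenvalues `1, -1` is reached from `h` by passing to negatives and by steps
from `X` to `X + N` with `⁅X, N⁆ = 2 N`. Such a step preserves an eigenline of `X`; starting at
`h`, one first produces an element of the form `h + 2 t f` which shares an eigenline with the
given one. -/
theorem sl2_induction {P : Sl2 K → Prop} (hH : P (sl2H K)) (hneg : ∀ X, P X → P (-X))
    (hadd : ∀ X N, P X → ⁅X, N⁆ = (2 : K) • N → P (X + N)) {a b c : K} (h : a * a + b * c = 1) :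
    P (sl2Mk a b c) := by
  rw [sl2H_eq] at hH
  have hH' : P (sl2Mk (-1) 0 0) := by simpa [sl2Mk_neg] using hneg _ hH
  by_cases ha : 1 + a = 0
  · obtain rfl : a = -1 := by linear_combination ha
    have hbc : b * c = 0 := by linear_combination h
    rcases mul_eq_zero.mp hbc with rfl | rfl
    · have := hadd _ (sl2Mk 0 0 c) hH' (by rw [sl2Mk_lie, sl2Mk_smul]; congr 1 <;> ring)
      simpa [sl2Mk_add] using this
    · have := hneg _ (hadd _ (sl2Mk 0 (-b) 0) hH
        (by rw [sl2Mk_lie, sl2Mk_smul]; congr 1 <;> ring))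
      simpa [sl2Mk_add, sl2Mk_neg] using this
  · obtain ⟨t, rfl⟩ : ∃ t, c = t * (1 + a) := ⟨c / (1 + a), (div_mul_cancel₀ _ ha).symm⟩
    have htb : t * b = 1 - a := by
      refine mul_left_cancel₀ ha ?_
      linear_combination h
    have h1 : P (sl2Mk 1 0 (2 * t)) := by
      have := hneg _ (hadd _ (sl2Mk 0 0 (-(2 * t))) hH'
        (by rw [sl2Mk_lie, sl2Mk_smul]; congr 1 <;> ring))
      simpa [sl2Mk_add, sl2Mk_neg] using this
    have h2 := hadd _ (sl2Mk (a - 1) b (t * (1 + a) - 2 * t)) h1 (by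
      rw [sl2Mk_lie, sl2Mk_smul]
      congr 1
      · linear_combination (-2) * htb
      · ring
      · ring)
    rw [sl2Mk_add] at h2
    convert h2 using 2 <;> ring

theorem sl2_eq_zero_or_discriminant_eq_one [CharZero K] {X Y Z : Sl2 K}
    (h : IsEquitableSl2 X Y Z) :
    X = 0 ∨ ∃ a b c, a * a + b * c = 1 ∧ X = sl2Mk a b c := by
  obtain ⟨hXY, hYZ, hZX⟩ := h
  obtain ⟨a, b, c, rfl⟩ := exists_eq_sl2Mk X
  by_cases hN : sl2Mk a b c + Y = 0
  · left
    rw [eq_neg_of_add_eq_zero_right hN, neg_lie, lie_skew, hZX] at hYZ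
    have h4 : (4 : K) • sl2Mk a b c = 0 := by
      rw [← sub_eq_zero] at hYZ
      rw [← hYZ]
      module
    exact (smul_eq_zero.mp h4).resolve_left (by norm_num)
  · right
    refine ⟨a, b, c, ?_, rfl⟩
    obtain ⟨p, r, s, hp⟩ := exists_eq_sl2Mk (sl2Mk a b c + Y)
    rw [hp] at hN
    refine sl2_discriminant_eq_one ?_ hN
    rw [← hp, lie_add, lie_self, zero_add, hXY, smul_add]

variable {V : Type*} [AddCommGroup V] [Module K V]

theorem weightsWithin_neg {A : Module.End K V} {d : ℕ}
    (hA : WeightsWithin (fun w : ℤ => -(w : K)) A d) :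
    WeightsWithin (fun w : ℤ => -(w : K)) (-A) d := by
  unfold WeightsWithin at *
  rw [← hA, ← iSup_eigenspace_reverse (fun w : ℤ => -(w : K))]
  refine iSup_congr fun i => iSup_congr fun _ => ?_
  ext v
  rw [Module.End.mem_eigenspace_iff, Module.End.mem_eigenspace_iff, LinearMap.neg_apply,
    neg_eq_iff_eq_neg, Int.cast_neg, neg_neg, neg_smul]

/-- The weights by which an equitable triple acts are bounded: its first element is `0`, or has on
`V` the same eigenvalues as `h`. -/
theorem exists_weightsWithin_of_isEquitableSl2 [CharZero K] [FiniteDimensional K V]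
    [LieRingModule (Sl2 K) V] [LieModule K (Sl2 K) V] (hV : IsSegregatedSl2 K V) {X Y Z : Sl2 K}
    (h : IsEquitableSl2 X Y Z) :
    ∃ d, WeightsWithin (fun w : ℤ => -(w : K)) (LieModule.toEnd K (Sl2 K) V X) d := by
  have hH : ∃ d, WeightsWithin (fun w : ℤ => -(w : K))
      (LieModule.toEnd K (Sl2 K) V (sl2H K)) d := by
    rcases hV with hV | hV
    · refine exists_weightsWithin 0 (top_le_iff.mp (hV.symm.le.trans (Submodule.span_mono ?_)))
      rintro v ⟨i, hi, hv⟩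
      exact ⟨-i, by simpa using hi, by simpa using hv⟩
    · refine exists_weightsWithin 1 (top_le_iff.mp (hV.symm.le.trans (Submodule.span_mono ?_)))
      rintro v ⟨i, hi, hv⟩
      exact ⟨-i, by simpa using hi.neg.add_one, by simpa using hv⟩
  rcases sl2_eq_zero_or_discriminant_eq_one h with rfl | ⟨a, b, c, habc, rfl⟩
  · refine ⟨0, ?_⟩
    unfold WeightsWithin
    rw [eq_top_iff]
    refine le_iSup₂_of_le 0 le_rfl fun v _ => ?_
    rw [Module.End.mem_eigenspace_iff]
    simp
  · obtain ⟨d, hd⟩ := hH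
    refine ⟨d, sl2_induction (P := fun X => WeightsWithin (fun w : ℤ => -(w : K))
      (LieModule.toEnd K (Sl2 K) V X) d) hd (fun X hX => ?_) (fun X N hX hN => ?_) habc⟩
    · rw [map_neg]
      exact weightsWithin_neg hX
    · rw [← neg_neg (X + N), map_neg]
      refine weightsWithin_neg (hX.of_triangular (fun m n hmn => ?_) fun w v hv => ?_)
      · simpa using hmn
      · rw [Module.End.mem_eigenspace_iff, LieModule.toEnd_apply_apply] at hv ⊢
        have hXN : ⁅X, ⁅N, v⁆⁆ = ((2 : K) - w) • ⁅N, v⁆ := by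
          rw [leibniz_lie, hN, hv, lie_smul, smul_lie]
          module
        have e : LieModule.toEnd K (Sl2 K) V (-(X + N)) v - (-((-w : ℤ) : K)) • v = -⁅N, v⁆ := by
          rw [LieModule.toEnd_apply_apply, neg_lie, add_lie, hv]
          push_cast
          module
        rw [e, lie_neg, hXN]
        push_cast
        module

end EquitableTriplesInSl2

/-! ### Equitable triples in `U_q(sl₂)` -/

section EquitableTriplesInUq

variable {K : Type*} [Field K] {q : K} {V : Type*} [AddCommGroup V] [Module K V]
  [Module (UqSl2 q) V]

theorem q_commutation_of_normalized {A : Type*} [Ring A] [Algebra K A] (hq1 : q - q⁻¹ ≠ 0)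
    {a b : A} (h : (q - q⁻¹)⁻¹ • (q • (a * b) - q⁻¹ • (b * a)) = 1) :
    q • (a * b) - q⁻¹ • (b * a) = (q - q⁻¹) • (1 : A) := by
  rw [← h, smul_smul, mul_inv_cancel₀ hq1, one_smul]

theorem isEquitableUq_generators (hq0 : q ≠ 0) (hq1 : q - q⁻¹ ≠ 0) :
    IsEquitableUq q (uqX q) (uqY q) (uqZ q) := by
  have hkek : uqGen q .kinv * uqGen q .e * uqGen q .k = (q ^ 2)⁻¹ • uqGen q .e := by
    rw [uq_kinv_mul_e hq0, smul_mul_assoc, mul_assoc, uq_kinv_mul_k, mul_one]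
  refine ⟨(uqUnitK q).isUnit, ?_, ?_, ?_⟩
  · rw [inv_smul_eq_iff₀ hq1, uqX, uqY, mul_add, add_mul, uq_k_mul_kinv, uq_kinv_mul_k,
      mul_smul_comm, uq_k_mul_f, smul_mul_assoc]
    match_scalars <;> field_simp
    ring
  · have e1 : uqGen q .f * (uqGen q .kinv * uqGen q .e) =
        (q ^ 2)⁻¹ • (uqGen q .f * uqGen q .e * uqGen q .kinv) := by
      rw [uq_kinv_mul_e hq0, mul_smul_comm, mul_assoc]
    have e2 : uqGen q .kinv * uqGen q .e * uqGen q .f =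
        uqGen q .f * uqGen q .e * uqGen q .kinv +
          (q - q⁻¹)⁻¹ • (1 - uqGen q .kinv * uqGen q .kinv) := by
      rw [mul_assoc, sub_eq_iff_eq_add.mp (uq_e_mul_f q), mul_add, mul_smul_comm, mul_sub,
        uq_kinv_mul_k, ← mul_assoc, uq_kinv_mul_f hq0, smul_mul_assoc, mul_assoc,
        uq_kinv_mul_e hq0, mul_smul_comm, smul_smul, mul_inv_cancel₀ (pow_ne_zero 2 hq0),
        one_smul, ← mul_assoc, add_comm]
    have e3 : uqGen q .kinv * (uqGen q .kinv * uqGen q .e) =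
        (q ^ 2)⁻¹ • (uqGen q .kinv * uqGen q .e * uqGen q .kinv) := by
      rw [uq_kinv_mul_e hq0, mul_smul_comm, ← mul_assoc, uq_kinv_mul_e hq0]
    rw [inv_smul_eq_iff₀ hq1, uqY, uqZ]
    simp only [mul_add, add_mul, mul_sub, sub_mul, mul_smul_comm, smul_mul_assoc]
    rw [e1, e2, e3, uq_kinv_mul_f hq0]
    match_scalars <;> field_simp <;> ring
  · have hkke : uqGen q .k * (uqGen q .kinv * uqGen q .e) = uqGen q .e := by
      rw [← mul_assoc, uq_k_mul_kinv, one_mul]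
    rw [inv_smul_eq_iff₀ hq1, uqX, uqZ, mul_sub (uqGen q .k), sub_mul (uqGen q .kinv),
      uq_k_mul_kinv, uq_kinv_mul_k, mul_smul_comm, smul_mul_assoc, hkek, hkke]
    match_scalars <;> field_simp
    ring

theorem uqCounit_unitK_zpow (q : K) (n : ℤ) :
    uqCounit q ((uqUnitK q ^ n : (UqSl2 q)ˣ) : UqSl2 q) = 1 := by
  have h : Units.map (uqCounit q : UqSl2 q →* K) (uqUnitK q) = 1 :=
    Units.ext (uqCounit_gen q .k)
  have h' := congrArg (fun u : Kˣ => (u : K)) (congrArg (· ^ n) h)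
  simpa [← map_zpow] using h'

theorem unitK_zpow_smul [IsScalarTower K (UqSl2 q) V] (hq0 : q ≠ 0) {i : ℤ} {v : V}
    (hv : uqGen q .k • v = q ^ i • v) (n : ℤ) :
    ((uqUnitK q ^ n : (UqSl2 q)ˣ) : UqSl2 q) • v = q ^ (i * n) • v := by
  have hcomm : ∀ (u : UqSl2 q) (c : K) (w : V), u • c • w = c • u • w := fun u c w => by
    rw [← smul_one_smul (UqSl2 q) c w, smul_smul, mul_smul_comm, mul_one, smul_assoc]
  have hinv : uqGen q .kinv • v = q ^ (-i) • v := by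
    have h := congrArg (fun w => q ^ (-i) • uqGen q .kinv • w) hv
    rw [smul_smul (uqGen q .kinv), uq_kinv_mul_k, one_smul, hcomm, smul_smul,
      ← zpow_add₀ hq0, neg_add_cancel, zpow_zero, one_smul] at h
    exact h.symm
  induction n with
  | zero => simp
  | succ n ih =>
    rw [zpow_add_one, Units.val_mul, mul_smul,
      show ((uqUnitK q : (UqSl2 q)ˣ) : UqSl2 q) = uqGen q .k from rfl, hv, hcomm, ih, smul_smul,
      ← zpow_add₀ hq0]
    congr 2
    ring
  | pred n ih =>
    rw [zpow_sub_one, Units.val_mul, mul_smul,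
      show (((uqUnitK q)⁻¹ : (UqSl2 q)ˣ) : UqSl2 q) = uqGen q .kinv from rfl, hinv, hcomm, ih,
      smul_smul, ← zpow_add₀ hq0]
    congr 2
    ring

/-- On a segregated module, the weights of `k ^ n` are the multiples by `n` of those of `k`, so
they also have the same parity. -/
theorem exists_weightsWithin_of_isSegregatedUq [FiniteDimensional K V]
    [IsScalarTower K (UqSl2 q) V] (hq0 : q ≠ 0) (hV : IsSegregatedUq q V) (n : ℤ) :
    ∃ d, WeightsWithin (fun w : ℤ => q ^ w)
      (uqAct V ((uqUnitK q ^ n : (UqSl2 q)ˣ) : UqSl2 q)) d := by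
  have key : ∀ p : ℕ, ∀ S : Set V, Submodule.span K S = ⊤ →
      (∀ v ∈ S, ∃ i : ℤ, Even (i * n + p) ∧ uqGen q .k • v = q ^ i • v) →
      ∃ d, WeightsWithin (fun w : ℤ => q ^ w)
        (uqAct V ((uqUnitK q ^ n : (UqSl2 q)ˣ) : UqSl2 q)) d := by
    intro p S hS h
    refine exists_weightsWithin p (top_le_iff.mp (hS.symm.le.trans (Submodule.span_mono ?_)))
    intro v hv
    obtain ⟨i, hi, hv⟩ := h v hv
    exact ⟨i * n, hi, unitK_zpow_smul hq0 hv n⟩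
  rcases hV with hV | hV
  · refine key 0 _ hV ?_
    rintro v ⟨i, hi, hv⟩
    exact ⟨i, by simpa using hi.mul_right n, hv⟩
  · rcases Int.even_or_odd n with hn | hn
    · refine key 0 _ hV ?_
      rintro v ⟨i, _, hv⟩
      exact ⟨i, by simpa using hn.mul_left i, hv⟩
    · refine key 1 _ hV ?_
      rintro v ⟨i, hi, hv⟩
      exact ⟨i, by simpa using (hi.mul hn).add_one, hv⟩

/-- The images of `x, y, z` in the commutative algebra `K` are pairwise inverse. -/
theorem uqCounit_mul_self_eq_one (hq1 : q - q⁻¹ ≠ 0) {x y z : UqSl2 q}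
    (h : IsEquitableUq q x y z) : uqCounit q x * uqCounit q x = 1 := by
  have key : ∀ a b : UqSl2 q, (q - q⁻¹)⁻¹ • (q • (a * b) - q⁻¹ • (b * a)) = 1 →
      uqCounit q a * uqCounit q b = 1 := by
    intro a b hab
    have h' := congrArg (uqCounit q) hab
    rw [map_smul, map_sub, map_smul, map_smul, map_mul, map_mul, map_one,
      mul_comm (uqCounit q b), ← sub_smul, smul_smul, inv_mul_cancel₀ hq1, one_smul] at h'
    exact h'
  obtain ⟨_, hxy, hyz, hzx⟩ := h
  have h1 := key _ _ hxy
  have h2 := key _ _ hyz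
  have h3 := key _ _ hzx
  linear_combination (-uqCounit q x * uqCounit q x) * h2 + (uqCounit q z * uqCounit q x) * h1 + h3

theorem hasConstantRatio_geomSeq (hq0 : q ≠ 0) (hq : ∀ n : ℕ, 0 < n → q ^ n ≠ 1) (d : ℕ) :
    HasConstantRatio (geomSeq q d) (q ^ 2)⁻¹ := by
  intro i _
  have hq2 : q ^ 2 - 1 ≠ 0 := sub_ne_zero.mpr (hq 2 two_pos)
  have hz : q ^ ((d : ℤ) - 2 * i - 4) ≠ 0 := zpow_ne_zero _ hq0
  have e0 : q ^ ((d : ℤ) - 2 * (i : ℤ)) = q ^ ((d : ℤ) - 2 * i - 4) * q ^ 4 := by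
    rw [← zpow_ofNat, ← zpow_add₀ hq0]; congr 1; ring
  have e1 : q ^ ((d : ℤ) - 2 * ((i + 1 : ℕ) : ℤ)) = q ^ ((d : ℤ) - 2 * i - 4) * q ^ 2 := by
    rw [← zpow_ofNat, ← zpow_add₀ hq0]; congr 1; push_cast; ring
  have e2 : q ^ ((d : ℤ) - 2 * ((i + 2 : ℕ) : ℤ)) = q ^ ((d : ℤ) - 2 * i - 4) := by
    congr 1; push_cast; ring
  simp only [geomSeq, e0, e1, e2]
  rw [div_eq_iff]
  · field_simp
  · rw [show q ^ ((d : ℤ) - 2 * i - 4) * q ^ 2 - q ^ ((d : ℤ) - 2 * i - 4) * q ^ 4 =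
      -(q ^ ((d : ℤ) - 2 * i - 4) * q ^ 2 * (q ^ 2 - 1)) by ring]
    exact neg_ne_zero.mpr (mul_ne_zero (mul_ne_zero hz (pow_ne_zero 2 hq0)) hq2)

theorem isReducedBDTripleBaseNeOne_of_isEquitableUq [FiniteDimensional K V] [Nontrivial V]
    [IsScalarTower K (UqSl2 q) V] (hq0 : q ≠ 0) (hq : ∀ n : ℕ, 0 < n → q ^ n ≠ 1)
    (hV : IsSegregatedUq q V) {x y z : UqSl2 q} (h : IsEquitableUq q x y z) :
    IsReducedBDTripleBaseNeOne q (uqAct V (uqCounit q x • x))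
      (uqAct V (uqCounit q x • y)) (uqAct V (uqCounit q x • z)) := by
  have hq1 := sub_inv_ne_zero hq0 hq
  have hε := uqCounit_mul_self_eq_one hq1 h
  obtain ⟨hunit, hxy, hyz, hzx⟩ := h
  have hspec : ∃ d, WeightsWithin (fun w : ℤ => q ^ w) (uqAct V (uqCounit q x • x)) d := by
    obtain ⟨c, n, rfl⟩ := exists_eq_smul_zpow_of_isUnit hq0 hq1 hunit
    have hc : uqCounit q (c • ((uqUnitK q ^ n : (UqSl2 q)ˣ) : UqSl2 q)) = c := by
      rw [map_smul, uqCounit_unitK_zpow, smul_eq_mul, mul_one]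
    rw [hc] at hε ⊢
    rw [smul_smul, hε, one_smul]
    exact exists_weightsWithin_of_isSegregatedUq hq0 hV n
  -- The relations are quadratic, hence insensitive to the sign `uqCounit q x`.
  have rel : ∀ a b : UqSl2 q, (q - q⁻¹)⁻¹ • (q • (a * b) - q⁻¹ • (b * a)) = 1 →
      q • (uqAct V (uqCounit q x • a) * uqAct V (uqCounit q x • b)) -
        q⁻¹ • (uqAct V (uqCounit q x • b) * uqAct V (uqCounit q x • a)) =
      (q - q⁻¹) • (1 : Module.End K V) := by
    intro a b hab
    have h' := congrArg (Algebra.lsmul K K V) (q_commutation_of_normalized hq1 hab)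
    simp only [uqAct, ← map_mul, smul_mul_smul_comm, hε, one_smul]
    simpa using h'
  have W := fun a b c (h1 : _) (h2 : _) (h3 : _) =>
    isWeightTriple_of_quantum (V := V) (x := a) (y := b) (z := c) hq0 hq h1 h2 h3
  obtain ⟨d, hd⟩ := IsWeightTriple.exists_isBDTripleWith (zpow_injective_of_pow_ne_one hq0 hq)
    (W _ _ _ (rel _ _ hxy) (rel _ _ hyz) (rel _ _ hzx))
    (W _ _ _ (rel _ _ hyz) (rel _ _ hzx) (rel _ _ hxy))
    (W _ _ _ (rel _ _ hzx) (rel _ _ hxy) (rel _ _ hyz)) hspec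
  have hr := hasConstantRatio_geomSeq hq0 hq d
  exact ⟨d, hd, fun h2 => ⟨(q ^ 2)⁻¹, inv_ne_one.mpr (hq 2 two_pos), rfl, fun _ => ⟨hr, hr, hr⟩,
    fun h1 => absurd h2 (by omega)⟩⟩

end EquitableTriplesInUq

/-! ### Reduced bidiagonal triples -/

theorem hasConstantRatio_linearSeq (K : Type*) [Field K] [CharZero K] (d : ℕ) :
    HasConstantRatio (linearSeq K d) 1 := by
  intro i _
  simp only [linearSeq]
  push_cast
  rw [div_eq_one_iff_eq]
  · ring
  · ring_nf
    exact two_ne_zero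

theorem isReducedBDTripleBaseOne_of_isEquitableSl2 {K V : Type*} [Field K] [CharZero K]
    [AddCommGroup V] [Module K V] [FiniteDimensional K V] [Nontrivial V]
    [LieRingModule (Sl2 K) V] [LieModule K (Sl2 K) V] (hV : IsSegregatedSl2 K V) {X Y Z : Sl2 K}
    (h : IsEquitableSl2 X Y Z) :
    IsReducedBDTripleBaseOne (LieModule.toEnd K (Sl2 K) V X)
      (LieModule.toEnd K (Sl2 K) V Y) (LieModule.toEnd K (Sl2 K) V Z) := by
  have hspec := exists_weightsWithin_of_isEquitableSl2 hV h
  obtain ⟨hXY, hYZ, hZX⟩ := h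
  have rel : ∀ A B : Sl2 K, ⁅A, B⁆ = (2 : K) • A + (2 : K) • B →
      LieModule.toEnd K (Sl2 K) V A * LieModule.toEnd K (Sl2 K) V B -
        LieModule.toEnd K (Sl2 K) V B * LieModule.toEnd K (Sl2 K) V A =
      (2 : K) • LieModule.toEnd K (Sl2 K) V A + (2 : K) • LieModule.toEnd K (Sl2 K) V B := by
    intro A B hAB
    ext v
    have h := lie_lie A B v
    rw [hAB, add_lie, smul_lie, smul_lie] at h
    exact h.symm
  have hinj : Function.Injective (fun w : ℤ => -(w : K)) := fun m n hmn => by simpa using hmn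
  have W := fun a b c (h1 : _) (h2 : _) (h3 : _) =>
    isWeightTriple_of_linear (K := K) (V := V) (x := a) (y := b) (z := c) h1 h2 h3
  obtain ⟨d, hd⟩ := IsWeightTriple.exists_isBDTripleWith hinj
    (W _ _ _ (rel _ _ hXY) (rel _ _ hYZ) (rel _ _ hZX))
    (W _ _ _ (rel _ _ hYZ) (rel _ _ hZX) (rel _ _ hXY))
    (W _ _ _ (rel _ _ hZX) (rel _ _ hXY) (rel _ _ hYZ)) hspec
  have hseq : (fun j : Fin (d + 1) => -(((d : ℤ) - 2 * ((j : ℕ) : ℤ) : ℤ) : K)) =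
      linearSeq K d := by
    funext j
    simp only [linearSeq]
    push_cast
    ring
  rw [hseq] at hd
  have hr := hasConstantRatio_linearSeq K d
  exact ⟨d, hd, fun _ => ⟨hr, hr, hr⟩, fun _ => rfl⟩

theorem theorem4p6 {K : Type u} [Field K] [IsAlgClosed K] [CharZero K] :
    -- the Lie algebra `sl₂`
    (∀ (V : Type v) [AddCommGroup V] [Module K V] [FiniteDimensional K V] [Nontrivial V]
        [LieRingModule (Sl2 K) V] [LieModule K (Sl2 K) V],
      IsSegregatedSl2 K V →
      ∀ X Y Z : Sl2 K, IsEquitableSl2 X Y Z →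
        IsReducedBDTripleBaseOne (LieModule.toEnd K (Sl2 K) V X)
          (LieModule.toEnd K (Sl2 K) V Y) (LieModule.toEnd K (Sl2 K) V Z)) ∧
    -- the quantum algebra `U_q(sl₂)`
    (∀ (q : K), q ≠ 0 → (∀ n : ℕ, 0 < n → q ^ n ≠ 1) →
      ∀ (V : Type v) [AddCommGroup V] [Module K V] [FiniteDimensional K V] [Nontrivial V]
        [Module (UqSl2 q) V] [IsScalarTower K (UqSl2 q) V],
      IsSegregatedUq q V →
      -- the equitable generators
      IsReducedBDTripleBaseNeOne q (uqAct V (uqX q)) (uqAct V (uqY q)) (uqAct V (uqZ q)) ∧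
      -- all equitable triples: the sign is the scalar by which `x` acts on the trivial module
      ∀ x y z : UqSl2 q, IsEquitableUq q x y z →
        (uqCounit q x = 1 ∨ uqCounit q x = -1) ∧
        IsReducedBDTripleBaseNeOne q (uqAct V (uqCounit q x • x))
          (uqAct V (uqCounit q x • y)) (uqAct V (uqCounit q x • z))) := by
  refine ⟨fun V _ _ _ _ _ _ hV X Y Z h => isReducedBDTripleBaseOne_of_isEquitableSl2 hV h,
    fun q hq0 hq V _ _ _ _ _ _ hV => ⟨?_, fun x y z h => ⟨?_, ?_⟩⟩⟩
  · have h := isReducedBDTripleBaseNeOne_of_isEquitableUq hq0 hq hV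
      (isEquitableUq_generators hq0 (sub_inv_ne_zero hq0 hq))
    have hX : uqCounit q (uqX q) = 1 := uqCounit_gen q .k
    simpa only [hX, one_smul] using h
  · exact mul_self_eq_one_iff.mp (uqCounit_mul_self_eq_one (sub_inv_ne_zero hq0 hq) h)
  · exact isReducedBDTripleBaseNeOne_of_isEquitableUq hq0 hq hV h
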